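/- Let $n\ge 2$. All manifolds are smooth, Hausdorff, second countable and of dimension $n+1$. A \emph{continuous} (respectively \emph{smooth}) spacetime is such a manifold with a Lorentzian metric of signature $(-,+,\dots,+)$ whose components in all coordinates are continuous (respectively smooth), time oriented by a continuous timelike vector field. A \emph{future directed timelike curve} is a Lipschitz curve $\gamma\colon[a,b]\to M_{\rm ext}$, $a<b$, such that, for some $\varepsilon>0$, $\gamma'$ is future directed timelike with $g_{\rm ext}(\gamma',\gamma')<-\varepsilon$ almost everywhere; a \emph{future directed causal curve} is a Lipschitz curve with $\gamma'$ future directed causal (nonzero) almost everywhere. $I^+(p,U)$ and $J^+(p,U)$ are the sets of endpoints of such timelike, respectively causal, curves that start at $p$ and lie in $U$; moreover $p\in J^+(p,U)$ for $p\in U$. Let $(M_{\rm ext},g_{\rm ext})$ be a continuous extension of a smooth spacetime $(M,g)$, that is, a continuous spacetime of the same dimension in which $M$ is a proper open subset with $g=g_{\rm ext}|_M$ and the restricted time orientation. Let $\partial^-M$ be the set of all $p\in\overline M\setminus M$ for which there is a future directed timelike curve $\gamma\colon[a,b]\to M_{\rm ext}$ with $\gamma(a)=p$ and $\gamma((a,b])\subset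 M$. Suppose that $M=I^+(\mathcal O,M_{\rm ext})$ for some $\mathcal O\in\partial^-M$. A function on $M$ \emph{extends continuously} to $M\cup\{\mathcal O\}$ if it is the restriction of a continuous function on $M\cup\{\mathcal O\}$ (with the subspace topology); a tensor field on $M$ extends continuously if its components in some coordinates around $\mathcal O$ do. Assume: (a) $(M,g)$ solves the Einstein equations with a perfect fluid $(u,\rho,p)$: $u$ is a smooth future directed timelike vector field on $M$ with $g(u,u)=-1$, $\rho$ and $p$ are smooth functions on $M$, and, with $u_*=g(u,\cdot)$, $$\mathrm{Ric}-\tfrac12 R\,g=8\pi\big[(\rho+p)\,u_*\otimes u_*+p\,g\big]\quad\text{on } M.$$ (b) Every (maximal) integral curve of $u$ in $M$ has past endpoint $\mathcal O$ in $M_{\rm ext}$, i.e. it converges to $\mathcal O$ as its parameter decreases to the lower end of its domain; and every continuous curve $\gamma\colon[a,b]\to M\cup\{\mathcal O\}$ with $\gamma(a)=\mathcal O$ that is an integral curve of $u$ in $M$ on $(a,b]$ is a future directed timelike curve in $M_{\rm ext}$. (c) The Ricci tensor $\mathrm{Ric}$ of $(M,g)$, $\rho$ and $p$ extend continuously to $M\cup\{\mathcal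 O\}$. Assume moreover at least one of the following: (d) $(M_{\rm ext},g_{\rm ext})$ is strongly causal at $\mathcal O$: every neighborhood $U$ of $\mathcal O$ contains a neighborhood $V$ of $\mathcal O$ such that every future directed causal curve with both endpoints in $V$ lies in $U$. (d$'$) Every neighborhood $U$ of $\mathcal O$ contains a neighborhood $V$ of $\mathcal O$ such that $\partial^-M\cap V\subset J^+(\mathcal O,V)$. Then the scalar curvature $R$ of $(M,g)$ extends continuously to $M\cup\{\mathcal O\}$, and the continuous extensions $\widetilde R$ and $\widetilde\rho$ of $R$ and $\rho$ satisfy $$\widetilde R(\mathcal O)=16\pi\,\frac{n+1}{n-1}\,\widetilde\rho(\mathcal O).$$ In particular, if the spacetime dimension is $n+1=4$, then $\widetilde R(\mathcal O)=32\pi\,\widetilde\rho(\mathcal O)$. -/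

import Mathlib

open Set Filter MeasureTheory
open scoped Manifold ContDiff Topology

noncomputable section

namespace C0Spacetime

/-- The coordinate space `ℝⁿ⁺¹`. -/
abbrev Coord (n : ℕ) : Type := EuclideanSpace ℝ (Fin (n + 1))

/-- The `i`-th standard unit vector of `ℝⁿ⁺¹`. -/
def stdVec (n : ℕ) (i : Fin (n + 1)) : Coord n := EuclideanSpace.single i (1 : ℝ)

variable {n : ℕ} {N : Type*} [TopologicalSpace N] [ChartedSpace (Coord n) N]

/-- A (not necessarily continuous) vector field on an `(n+1)`-dimensional manifold. -/
abbrev VecField (n : ℕ) (N : Type*) [TopologicalSpace N] [ChartedSpace (Coord n) N] : Type _ :=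
  (x : N) → TangentSpace (𝓡 (n + 1)) x

/-- A (not necessarily continuous) covariant 2-tensor field on an `(n+1)`-dimensional manifold. -/
abbrev Tensor2 (n : ℕ) (N : Type*) [TopologicalSpace N] [ChartedSpace (Coord n) N] : Type _ :=
  (x : N) → LinearMap.BilinForm ℝ (TangentSpace (𝓡 (n + 1)) x)

/-- The charts (coordinate systems) of the smooth structure of `N`. -/
abbrev IsSmoothChart (e : OpenPartialHomeomorph N (Coord n)) : Prop :=
  e ∈ IsManifold.maximalAtlas (𝓡 (n + 1)) ∞ N

/-! ### Components in coordinates -/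

/-- The coordinate vector `∂ᵢ` of the chart `e`, at the point with coordinates `y`. -/
def coordVec (e : OpenPartialHomeomorph N (Coord n)) (i : Fin (n + 1)) (y : Coord n) :
    TangentSpace (𝓡 (n + 1)) (e.symm y) :=
  mfderiv (𝓡 (n + 1)) (𝓡 (n + 1)) e.symm y (stdVec n i)

/-- The differential `dxⁱ` of the `i`-th coordinate function of the chart `e`, at `x`. -/
def coordCovec (e : OpenPartialHomeomorph N (Coord n)) (i : Fin (n + 1)) (x : N) :
    TangentSpace (𝓡 (n + 1)) x →ₗ[ℝ] ℝ :=
  (EuclideanSpace.proj i : Coord n →L[ℝ] ℝ).toLinearMap ∘ₗ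
    (mfderiv (𝓡 (n + 1)) (𝓡 (n + 1)) e x).toLinearMap

/-- The component `Tᵢⱼ = T(∂ᵢ, ∂ⱼ)` in the chart `e`, as a function of the coordinates `y`. -/
def comp (T : Tensor2 n N) (e : OpenPartialHomeomorph N (Coord n)) (i j : Fin (n + 1))
    (y : Coord n) : ℝ :=
  T (e.symm y) (coordVec e i y) (coordVec e j y)

/-- The matrix of all components in the chart `e`. -/
def compMatrix (T : Tensor2 n N) (e : OpenPartialHomeomorph N (Coord n)) (y : Coord n) :
    Matrix (Fin (n + 1)) (Fin (n + 1)) ℝ :=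
  Matrix.of fun i j => comp T e i j y

/-! ### Curvature -/

/-- The partial derivative `∂ᵢ f` of a function of the coordinates. -/
def pderiv (i : Fin (n + 1)) (f : Coord n → ℝ) (y : Coord n) : ℝ :=
  fderiv ℝ f y (stdVec n i)

/-- The Christoffel symbol `Γᵏᵢⱼ` of `g` in the chart `e`. -/
def christoffel (g : Tensor2 n N) (e : OpenPartialHomeomorph N (Coord n))
    (k i j : Fin (n + 1)) (y : Coord n) : ℝ :=
  (1 / 2) * ∑ l, (compMatrix g e y)⁻¹ k l *
    (pderiv i (comp g e j l) y + pderiv j (comp g e i l) y - pderiv l (comp g e i j) y)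

/-- The component `Rᵢⱼ` of the Ricci tensor of `g` in the chart `e`:
`Rᵢⱼ = ∂ₖΓᵏᵢⱼ - ∂ⱼΓᵏᵢₖ + ΓᵏₖₗΓˡᵢⱼ - ΓᵏⱼₗΓˡᵢₖ` (summed over `k` and `l`). -/
def ricciComp (g : Tensor2 n N) (e : OpenPartialHomeomorph N (Coord n))
    (i j : Fin (n + 1)) (y : Coord n) : ℝ :=
  ∑ k, (pderiv k (christoffel g e k i j) y - pderiv j (christoffel g e k i k) y) +
    ∑ k, ∑ l, (christoffel g e k k l y * christoffel g e l i j y -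
      christoffel g e k j l y * christoffel g e l i k y)

/-- The Ricci tensor `Ric = Rᵢⱼ dxⁱ ⊗ dxʲ`, computed at `x` in the preferred chart at `x`
(any other smooth chart around `x` gives the same bilinear form). -/
def ricci (g : Tensor2 n N) : Tensor2 n N := fun x =>
  ∑ i, ∑ j, ricciComp g (chartAt (Coord n) x) i j (chartAt (Coord n) x x) •
    LinearMap.BilinForm.linMulLin (coordCovec (chartAt (Coord n) x) i x)
      (coordCovec (chartAt (Coord n) x) j x)

/-- The scalar curvature `R = gⁱʲ Ric(∂ᵢ, ∂ⱼ)`, computed at `x` in the preferred chart at `x`. -/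
def scalarCurvature (g : Tensor2 n N) (x : N) : ℝ :=
  ∑ i, ∑ j, (compMatrix g (chartAt (Coord n) x) (chartAt (Coord n) x x))⁻¹ i j *
    comp (ricci g) (chartAt (Coord n) x) i j (chartAt (Coord n) x x)

/-! ### Spacetimes -/

/-- `b` is a symmetric bilinear form of signature `(-, +, …, +)`: it has an orthonormal basis. -/
def IsLorentzForm {V : Type*} [AddCommGroup V] [Module ℝ V] (n : ℕ)
    (b : LinearMap.BilinForm ℝ V) : Prop :=
  ∃ e : Module.Basis (Fin (n + 1)) ℝ V,
    ∀ i j, b (e i) (e j) = if i = j then (if i = 0 then -1 else 1) else 0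

/-- `(N, g)` is a continuous spacetime: `g` is a Lorentzian metric with continuous components in
all coordinates, time oriented by the continuous timelike vector field `X`. -/
structure IsContinuousSpacetime [IsManifold (𝓡 (n + 1)) ∞ N] (g : Tensor2 n N)
    (X : VecField n N) : Prop where
  lorentz : ∀ x, IsLorentzForm n (g x)
  continuous_metric : ∀ e : OpenPartialHomeomorph N (Coord n), IsSmoothChart e →
    ∀ i j, ContinuousOn (comp g e i j) e.target
  continuous_orientation :
    Continuous fun x => (⟨x, X x⟩ : TangentBundle (𝓡 (n + 1)) N)
  timelike_orientation : ∀ x, g x (X x) (X x) < 0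

/-- The components of `g` in all coordinates are smooth on the open set `M`. -/
def IsSmoothMetricOn (g : Tensor2 n N) (M : Set N) : Prop :=
  ∀ e : OpenPartialHomeomorph N (Coord n), IsSmoothChart e →
    ∀ i j, ContDiffOn ℝ ∞ (comp g e i j) (e.target ∩ e.symm ⁻¹' M)

/-- `(N, g)` with the time orientation `X` is a continuous extension of the smooth spacetime
`(M, g|_M)`. The smaller spacetime is identified with its image, which is an open subset because
the dimensions agree, and carries the restrictions of the metric and of the time orientation. -/
structure IsContinuousExtension [IsManifold (𝓡 (n + 1)) ∞ N] (g : Tensor2 n N)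
    (X : VecField n N) (M : Set N) : Prop where
  spacetime : IsContinuousSpacetime g X
  isOpen : IsOpen M
  nonempty : M.Nonempty
  proper : M ≠ univ
  smooth : IsSmoothMetricOn g M

/-! ### Causality -/

/-- `v` is a future directed timelike vector. -/
def IsFutureTimelike (g : Tensor2 n N) (X : VecField n N) (x : N)
    (v : TangentSpace (𝓡 (n + 1)) x) : Prop :=
  g x v v < 0 ∧ g x (X x) v < 0

/-- `v` is a future directed causal (timelike or null, nonzero) vector. -/
def IsFutureCausal (g : Tensor2 n N) (X : VecField n N) (x : N)
    (v : TangentSpace (𝓡 (n + 1)) x) : Prop :=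
  v ≠ 0 ∧ g x v v ≤ 0 ∧ g x (X x) v < 0

/-- The velocity `γ'(t)` (zero where `γ` is not differentiable). -/
def velocity (γ : ℝ → N) (t : ℝ) : TangentSpace (𝓡 (n + 1)) (γ t) :=
  mfderiv 𝓘(ℝ, ℝ) (𝓡 (n + 1)) γ t (1 : ℝ)

/-- `γ : [a, b] → N` is a Lipschitz curve (only the values of `γ` on `[a, b]` matter): it is
continuous, and near each parameter it is Lipschitz in the coordinates. -/
def IsLipschitzCurve (n : ℕ) {N : Type*} [TopologicalSpace N] [ChartedSpace (Coord n) N]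
    (γ : ℝ → N) (a b : ℝ) : Prop :=
  ContinuousOn γ (Icc a b) ∧
    ∀ t ∈ Icc a b, ∃ K, ∃ s ∈ 𝓝[Icc a b] t, LipschitzOnWith K (chartAt (Coord n) (γ t) ∘ γ) s

/-- `γ : [a, b] → N` is a future directed timelike curve. -/
def IsTimelikeCurve (g : Tensor2 n N) (X : VecField n N) (γ : ℝ → N) (a b : ℝ) : Prop :=
  a < b ∧ IsLipschitzCurve n γ a b ∧ ∃ ε > 0, ∀ᵐ t ∂volume.restrict (Ioo a b),
    IsFutureTimelike g X (γ t) (velocity γ t) ∧ g (γ t) (velocity γ t) (velocity γ t) < -ε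

/-- `γ : [a, b] → N` is a future directed causal curve. -/
def IsCausalCurve (g : Tensor2 n N) (X : VecField n N) (γ : ℝ → N) (a b : ℝ) : Prop :=
  a < b ∧ IsLipschitzCurve n γ a b ∧ ∀ᵐ t ∂volume.restrict (Ioo a b),
    IsFutureCausal g X (γ t) (velocity γ t)

/-- The timelike future `I⁺(p, U)`. -/
def timelikeFuture (g : Tensor2 n N) (X : VecField n N) (p : N) (U : Set N) : Set N :=
  {q | ∃ (γ : ℝ → N) (a b : ℝ), IsTimelikeCurve g X γ a b ∧ MapsTo γ (Icc a b) U ∧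
    γ a = p ∧ γ b = q}

/-- The causal future `J⁺(p, U)`; it contains `p` itself. -/
def causalFuture (g : Tensor2 n N) (X : VecField n N) (p : N) (U : Set N) : Set N :=
  {q | (q = p ∧ p ∈ U) ∨ ∃ (γ : ℝ → N) (a b : ℝ), IsCausalCurve g X γ a b ∧
    MapsTo γ (Icc a b) U ∧ γ a = p ∧ γ b = q}

/-- The past boundary `∂⁻M`: the points of `∂M = closure M \ M` from which some future directed
timelike curve starts that lies in `M` afterwards. -/
def pastBoundary (g : Tensor2 n N) (X : VecField n N) (M : Set N) : Set N :=
  {p | p ∈ closure M \ M ∧ ∃ (γ : ℝ → N) (a b : ℝ), IsTimelikeCurve g X γ a b ∧ γ a = p ∧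
    MapsTo γ (Ioc a b) M}

/-- The spacetime is strongly causal at `O`. -/
def IsStronglyCausalAt (g : Tensor2 n N) (X : VecField n N) (O : N) : Prop :=
  ∀ U ∈ 𝓝 O, ∃ V ∈ 𝓝 O, V ⊆ U ∧ ∀ (γ : ℝ → N) (a b : ℝ), IsCausalCurve g X γ a b →
    γ a ∈ V → γ b ∈ V → MapsTo γ (Icc a b) U

/-- Every neighborhood of `O` contains a neighborhood `V` of `O` with `∂⁻M ∩ V ⊆ J⁺(O, V)`. -/
def PastBoundaryLocallyInFuture (g : Tensor2 n N) (X : VecField n N) (M : Set N) (O : N) : Prop :=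
  ∀ U ∈ 𝓝 O, ∃ V ∈ 𝓝 O, V ⊆ U ∧ pastBoundary g X M ∩ V ⊆ causalFuture g X O V

/-! ### Continuous extensions to `M ∪ {O}` -/

/-- `f'` is a continuous extension of `f : M → ℝ` to `M ∪ {O}` (only the values of `f` on `M` and
those of `f'` on `M ∪ {O}` matter). -/
def IsContExt (M : Set N) (O : N) (f f' : N → ℝ) : Prop :=
  ContinuousOn f' (insert O M) ∧ EqOn f' f M

/-- The tensor field `T` on `M` extends continuously to `M ∪ {O}`: in some coordinates around `O`
all its components do. -/
def TensorExtends (T : Tensor2 n N) (M : Set N) (O : N) : Prop :=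
  ∃ e : OpenPartialHomeomorph N (Coord n), IsSmoothChart e ∧ O ∈ e.source ∧
    ∀ i j, ∃ f : N → ℝ, IsContExt (e.source ∩ M) O (fun x => comp T e i j (e x)) f

/-! ### Perfect fluids -/

/-- `(M, g)` solves the Einstein equations `Ric - R g / 2 = 8π [(ρ + p) u⋆ ⊗ u⋆ + p g]` with the
perfect fluid `(u, ρ, p)`. -/
structure IsPerfectFluidSolution [IsManifold (𝓡 (n + 1)) ∞ N] (g : Tensor2 n N)
    (X : VecField n N) (M : Set N) (u : VecField n N) (ρ p : N → ℝ) : Prop where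
  smooth_u : ContMDiffOn (𝓡 (n + 1)) (𝓡 (n + 1)).tangent ∞
    (fun x => (⟨x, u x⟩ : TangentBundle (𝓡 (n + 1)) N)) M
  smooth_ρ : ContMDiffOn (𝓡 (n + 1)) 𝓘(ℝ, ℝ) ∞ ρ M
  smooth_p : ContMDiffOn (𝓡 (n + 1)) 𝓘(ℝ, ℝ) ∞ p M
  unit : ∀ x ∈ M, g x (u x) (u x) = -1
  future : ∀ x ∈ M, IsFutureTimelike g X x (u x)
  einstein : ∀ x ∈ M, ∀ v w : TangentSpace (𝓡 (n + 1)) x,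
    ricci g x v w - (1 / 2) * scalarCurvature g x * g x v w =
      8 * Real.pi * ((ρ x + p x) * (g x (u x) v * g x (u x) w) + p x * g x v w)

/-- `γ : J → M` is an integral curve of `u`, defined on the nonempty open interval `J`. -/
def IsIntegralCurveIn (u : VecField n N) (M : Set N) (γ : ℝ → N) (J : Set ℝ) : Prop :=
  IsOpen J ∧ J.Nonempty ∧ J.OrdConnected ∧ MapsTo γ J M ∧ IsMIntegralCurveOn γ u J

/-- `γ : J → M` is an integral curve of `u` in `M` that cannot be extended to a larger interval. -/
def IsMaximalIntegralCurveIn (u : VecField n N) (M : Set N) (γ : ℝ → N) (J : Set ℝ) : Prop :=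
  IsIntegralCurveIn u M γ J ∧ ∀ (γ' : ℝ → N) (J' : Set ℝ), IsIntegralCurveIn u M γ' J' →
    J ⊆ J' → EqOn γ' γ J → J' = J

/-- All the integral curves of `u` have past endpoint `O`: each maximal integral curve tends to `O`
as its parameter decreases to the lower end of its interval. The extended curves are future directed
timelike on compact domains. -/
structure HasPastEndpoint (g : Tensor2 n N) (X : VecField n N) (M : Set N) (u : VecField n N)
    (O : N) : Prop where
  tendsto : ∀ (γ : ℝ → N) (J : Set ℝ), IsMaximalIntegralCurveIn u M γ J →
    Tendsto (fun t : J => γ t) atBot (𝓝 O)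
  timelike : ∀ (γ : ℝ → N) (a b : ℝ), a < b → ContinuousOn γ (Icc a b) → γ a = O →
    MapsTo γ (Ioc a b) M → IsMIntegralCurveOn γ u (Ioc a b) → IsTimelikeCurve g X γ a b

end C0Spacetime

end

open C0Spacetime

/-!
The trace of the Einstein equations is `R = 16π (ρ - n p) / (n - 1)`, so `R` extends, and the claim
is that `ρ + p` vanishes at `O`. Suppose it does not. Then the Einstein equations make `u⋆ ⊗ u⋆`
converge at `O`. The reverse Cauchy–Schwarz inequality keeps `g(X, u)` away from `0`, and therefore
`u` itself converges, in coordinates, to a future directed timelike vector `U`. Let `v ≠ U` be close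
to `U` but not parallel to it, and follow the flow line through the point `O + s v` of `I⁺(O) = M`
backwards, for a small `s > 0`. It is almost straight with direction `U`, so it cannot reach `O`
within a small coordinate ball. It leaves the ball at some `z ∈ M = I⁺(O)` such that `O - z` is
almost parallel to `U`. Hence `O ∈ I⁺(z) ⊆ I⁺(O) = M`, which is absurd.
-/

namespace C0Spacetime

section LorentzForm

variable {V : Type*} [AddCommGroup V] [Module ℝ V] {n : ℕ} {b : LinearMap.BilinForm ℝ V}

theorem IsLorentzForm.isSymm (hb : IsLorentzForm n b) : b.IsSymm := by
  obtain ⟨e, he⟩ := hb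
  refine (LinearMap.BilinForm.isSymm_iff_basis e).2 fun i j => ?_
  rw [he, he]
  grind

theorem IsLorentzForm.nondegenerate (hb : IsLorentzForm n b) : b.Nondegenerate := by
  obtain ⟨e, he⟩ := hb
  refine LinearMap.IsOrthoᵢ.nondegenerate_of_not_isOrtho_basis_self e (fun i j hij => ?_)
    fun i => ?_
  · exact (he i j).trans (if_neg hij)
  · rw [he, if_pos rfl]
    split_ifs <;> norm_num

theorem IsLorentzForm.exists_basis_apply_eq (hb : IsLorentzForm n b) :
    ∃ e : Module.Basis (Fin (n + 1)) ℝ V, ∀ v w,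
      b v w = -(e.repr v 0 * e.repr w 0) + ∑ i : Fin n, e.repr v i.succ * e.repr w i.succ := by
  obtain ⟨e, he⟩ := hb
  refine ⟨e, fun v w => ?_⟩
  rw [← LinearMap.sum_repr_mul_repr_mul e e, Finsupp.sum_fintype _ _ (by simp)]
  simp [he, Finsupp.sum_fintype, Fin.sum_univ_succ]

theorem IsLorentzForm.nonneg_of_orthogonal (hb : IsLorentzForm n b) {v w : V} (hv : b v v < 0)
    (hvw : b v w = 0) : 0 ≤ b w w := by
  obtain ⟨e, he⟩ := hb.exists_basis_apply_eq
  have hcs := Finset.sum_mul_sq_le_sq_mul_sq Finset.univ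
    (fun i : Fin n => e.repr v i.succ) (fun i : Fin n => e.repr w i.succ)
  simp only [he, ← sq] at hv hvw ⊢
  have hv_space : 0 ≤ ∑ i : Fin n, e.repr v i.succ ^ 2 := Finset.sum_nonneg fun i _ => sq_nonneg _
  rw [← neg_eq_zero, neg_add, neg_neg, add_neg_eq_zero] at hvw
  rw [← hvw, mul_pow] at hcs
  by_contra! hw
  rw [neg_add_neg_iff] at hv hw
  have hw_space : 0 ≤ ∑ i : Fin n, e.repr w i.succ ^ 2 := Finset.sum_nonneg fun i _ => sq_nonneg _
  have h1 := mul_le_mul_of_nonneg_left hw.le hv_space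
  have h2 := mul_lt_mul_of_pos_right hv (hw_space.trans_lt hw)
  linarith

/-- The vector `b v w • v - b v v • w` is orthogonal to `v`. -/
theorem IsLorentzForm.mul_le_sq (hb : IsLorentzForm n b) {v w : V} (hv : b v v < 0) :
    b v v * b w w ≤ b v w ^ 2 := by
  have h := hb.nonneg_of_orthogonal (w := b v w • v - b v v • w) hv (by
    simp only [map_sub, map_smul, smul_eq_mul]
    ring)
  simp only [map_sub, map_smul, LinearMap.sub_apply, LinearMap.smul_apply, smul_eq_mul,
    hb.isSymm.eq w v] at h
  nlinarith

end LorentzForm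

theorem trace_inv_mul_add_vecMulVec {ι K : Type*} [Fintype ι] [DecidableEq ι] [Field K]
    {G : Matrix ι ι K} (hG : G.det ≠ 0) (U : ι → K) (a b : K) :
    (G⁻¹ * (a • G + b • Matrix.vecMulVec (G.mulVec U) (G.mulVec U))).trace =
      a * Fintype.card ι + b * (U ⬝ᵥ G.mulVec U) := by
  have hG' : G⁻¹ * G = 1 := G.nonsing_inv_mul hG.isUnit
  simp only [Matrix.mul_add, Matrix.mul_smul, Matrix.mul_vecMulVec, Matrix.mulVec_mulVec, hG',
    Matrix.one_mulVec, Matrix.trace_add, Matrix.trace_smul, Matrix.trace_one,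
    Matrix.trace_vecMulVec, smul_eq_mul]

section Chart

variable {n : ℕ} {N : Type*} [TopologicalSpace N] [ChartedSpace (Coord n) N]

/-- The coordinates of a tangent vector at `x` in the chart `e`. -/
noncomputable def chartVec (e : OpenPartialHomeomorph N (Coord n)) (x : N)
    (v : TangentSpace (𝓡 (n + 1)) x) : Coord n :=
  mfderiv (𝓡 (n + 1)) (𝓡 (n + 1)) e x v

/-- The bilinear form `Tᵢⱼ vⁱ wʲ` on `ℝⁿ⁺¹` given by the components of `T` in the chart `e` at the
point with coordinates `y`. -/
noncomputable def chartForm (T : Tensor2 n N) (e : OpenPartialHomeomorph N (Coord n))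
    (y v w : Coord n) : ℝ :=
  v.ofLp ⬝ᵥ (compMatrix T e y).mulVec w.ofLp

variable {e : OpenPartialHomeomorph N (Coord n)}

theorem IsSmoothChart.mdifferentiable (he : IsSmoothChart e) :
    e.MDifferentiable (𝓡 (n + 1)) (𝓡 (n + 1)) :=
  ⟨(contMDiffOn_of_mem_maximalAtlas he).mdifferentiableOn (by simp),
    (contMDiffOn_symm_of_mem_maximalAtlas he).mdifferentiableOn (by simp)⟩

variable {y : Coord n}

/-- The coordinate vectors of the chart `e` at the point with coordinates `y`, as a basis of the
tangent space. -/
noncomputable def coordBasis (he : IsSmoothChart e) (hy : y ∈ e.target) :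
    Module.Basis (Fin (n + 1)) ℝ (TangentSpace (𝓡 (n + 1)) (e.symm y)) :=
  (EuclideanSpace.basisFun (Fin (n + 1)) ℝ).toBasis.map
    (he.mdifferentiable.symm.mfderiv hy).toLinearEquiv

theorem coordBasis_apply (he : IsSmoothChart e) (hy : y ∈ e.target) (i : Fin (n + 1)) :
    coordBasis he hy i = coordVec e i y := by
  have h : (EuclideanSpace.basisFun (Fin (n + 1)) ℝ).toBasis i = stdVec n i := by simp [stdVec]
  exact (Module.Basis.map_apply _ _ _).trans (congrArg (he.mdifferentiable.symm.mfderiv hy) h)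

theorem coordBasis_repr (he : IsSmoothChart e) (hy : y ∈ e.target)
    (v : TangentSpace (𝓡 (n + 1)) (e.symm y)) :
    ⇑((coordBasis he hy).repr v) = (chartVec e (e.symm y) v).ofLp :=
  rfl

theorem compMatrix_eq_toMatrix (T : Tensor2 n N) (he : IsSmoothChart e) (hy : y ∈ e.target) :
    compMatrix T e y = LinearMap.BilinForm.toMatrix (coordBasis he hy) (T (e.symm y)) := by
  ext i j
  rw [LinearMap.BilinForm.toMatrix_apply, coordBasis_apply, coordBasis_apply]
  rfl

theorem apply_eq_chartForm (T : Tensor2 n N) (he : IsSmoothChart e) (hy : y ∈ e.target)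
    (v w : TangentSpace (𝓡 (n + 1)) (e.symm y)) :
    T (e.symm y) v w = chartForm T e y (chartVec e (e.symm y) v) (chartVec e (e.symm y) w) := by
  rw [LinearMap.BilinForm.apply_eq_dotProduct_toMatrix_mulVec (coordBasis he hy),
    coordBasis_repr, coordBasis_repr, ← compMatrix_eq_toMatrix, chartForm]

theorem apply_coordVec (T : Tensor2 n N) (he : IsSmoothChart e) (hy : y ∈ e.target)
    (i : Fin (n + 1)) (v : TangentSpace (𝓡 (n + 1)) (e.symm y)) :
    T (e.symm y) (coordVec e i y) v =
      (compMatrix T e y).mulVec (chartVec e (e.symm y) v).ofLp i := by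
  rw [← coordBasis_apply he hy,
    LinearMap.BilinForm.apply_eq_dotProduct_toMatrix_mulVec (coordBasis he hy),
    Module.Basis.repr_self, Finsupp.single_eq_pi_single, single_one_dotProduct, coordBasis_repr,
    ← compMatrix_eq_toMatrix]

variable {g : Tensor2 n N}

theorem isSymm_compMatrix (hg : ∀ x, IsLorentzForm n (g x)) (he : IsSmoothChart e)
    (hy : y ∈ e.target) : (compMatrix g e y).IsSymm := by
  rw [compMatrix_eq_toMatrix g he hy]
  exact (LinearMap.BilinForm.isSymm_toMatrix_iff_isSymm _).2 (hg _).isSymm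

theorem det_compMatrix_ne_zero (hg : ∀ x, IsLorentzForm n (g x)) (he : IsSmoothChart e)
    (hy : y ∈ e.target) : (compMatrix g e y).det ≠ 0 := by
  rw [compMatrix_eq_toMatrix g he hy]
  exact (LinearMap.BilinForm.nondegenerate_iff_det_ne_zero _).1 (hg _).nondegenerate

variable [IsManifold (𝓡 (n + 1)) ∞ N] {X u : VecField n N} {M : Set N} {ρ p : N → ℝ}

theorem IsPerfectFluidSolution.compMatrix_ricci (h : IsPerfectFluidSolution g X M u ρ p)
    (hg : ∀ x, IsLorentzForm n (g x)) (he : IsSmoothChart e) (hy : y ∈ e.target)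
    (hyM : e.symm y ∈ M) :
    compMatrix (ricci g) e y =
      (1 / 2 * scalarCurvature g (e.symm y) + 8 * Real.pi * p (e.symm y)) • compMatrix g e y +
        (8 * Real.pi * (ρ (e.symm y) + p (e.symm y))) •
          Matrix.vecMulVec ((compMatrix g e y).mulVec (chartVec e _ (u (e.symm y))).ofLp)
            ((compMatrix g e y).mulVec (chartVec e _ (u (e.symm y))).ofLp) := by
  ext i j
  have hE := h.einstein (e.symm y) hyM (coordVec e i y) (coordVec e j y)
  simp only [(hg (e.symm y)).isSymm.eq (u _), apply_coordVec g he hy _ (u _)] at hE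
  simp only [compMatrix, comp, Matrix.of_apply, Matrix.add_apply, Matrix.smul_apply,
    Matrix.vecMulVec_apply, smul_eq_mul] at hE ⊢
  linarith

theorem IsPerfectFluidSolution.scalarCurvature_eq (h : IsPerfectFluidSolution g X M u ρ p)
    (hn : 2 ≤ n) (hg : ∀ x, IsLorentzForm n (g x)) {x : N} (hx : x ∈ M) :
    scalarCurvature g x = 16 * Real.pi / ((n : ℝ) - 1) * (ρ x - n * p x) := by
  set e := chartAt (Coord n) x
  have he : IsSmoothChart e := IsManifold.chart_mem_maximalAtlas x
  have hy : e x ∈ e.target := mem_chart_target (Coord n) x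
  have hxe : e.symm (e x) = x := e.left_inv (mem_chart_source (Coord n) x)
  have hunit := h.unit x hx
  rw [← hxe, apply_eq_chartForm g he hy, chartForm, hxe] at hunit
  have htrace : scalarCurvature g x =
      ((compMatrix g e (e x))⁻¹ * (compMatrix (ricci g) e (e x)).transpose).trace := by
    simp only [scalarCurvature, Matrix.trace, Matrix.diag, Matrix.mul_apply,
      Matrix.transpose_apply, compMatrix, Matrix.of_apply, e]
  rw [h.compMatrix_ricci hg he hy (hxe.symm ▸ hx), Matrix.transpose_add, Matrix.transpose_smul,
    Matrix.transpose_smul, Matrix.transpose_vecMulVec, isSymm_compMatrix hg he hy,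
    trace_inv_mul_add_vecMulVec (det_compMatrix_ne_zero hg he hy), hxe, hunit,
    Fintype.card_fin] at htrace
  have hn1 : (n : ℝ) - 1 ≠ 0 := by
    have : (2 : ℝ) ≤ n := by exact_mod_cast hn
    linarith
  push_cast at htrace
  field_simp
  linarith

end Chart

theorem lipschitzOnWith_union_of_le {E : Type*} [PseudoMetricSpace E] {f : ℝ → E} {s t : Set ℝ}
    {b : ℝ} {K L : NNReal} (hs : ∀ x ∈ s, x ≤ b) (ht : ∀ x ∈ t, b ≤ x) (hbs : b ∈ s) (hbt : b ∈ t)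
    (hfs : LipschitzOnWith K f s) (hft : LipschitzOnWith L f t) :
    LipschitzOnWith (max K L) f (s ∪ t) := by
  have hs' := hfs.weaken (le_max_left K L)
  have ht' := hft.weaken (le_max_right K L)
  have hst : ∀ x ∈ s, ∀ y ∈ t, dist (f x) (f y) ≤ (max K L : NNReal) * dist x y := by
    intro x hx y hy
    have hdist : dist x y = dist x b + dist b y := by
      simp only [Real.dist_eq, abs_of_nonpos, sub_nonpos, hs x hx, ht y hy,
        (hs x hx).trans (ht y hy)]
      ring
    calc dist (f x) (f y) ≤ dist (f x) (f b) + dist (f b) (f y) := dist_triangle _ _ _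
      _ ≤ max K L * dist x b + max K L * dist b y :=
        add_le_add (hs'.dist_le_mul x hx b hbs) (ht'.dist_le_mul b hbt y hy)
      _ = max K L * dist x y := by rw [hdist, mul_add]
  refine LipschitzOnWith.of_dist_le_mul ?_
  rintro x (hx | hx) y (hy | hy)
  · exact hs'.dist_le_mul x hx y hy
  · exact hst x hx y hy
  · rw [dist_comm, dist_comm x]
    exact hst y hy x hx
  · exact ht'.dist_le_mul x hx y hy

section Curves

variable {n : ℕ} {N : Type*} [TopologicalSpace N] [ChartedSpace (Coord n) N]
  {g : Tensor2 n N} {X : VecField n N} {γ γ' : ℝ → N} {a b c : ℝ}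

theorem IsLipschitzCurve.congr (h : IsLipschitzCurve n γ a b) (hγ : EqOn γ γ' (Icc a b)) :
    IsLipschitzCurve n γ' a b := by
  refine ⟨h.1.congr hγ.symm, fun t ht => ?_⟩
  obtain ⟨K, s, hs, hK⟩ := h.2 t ht
  refine ⟨K, s ∩ Icc a b, inter_mem hs self_mem_nhdsWithin, fun x hx y hy => ?_⟩
  simpa only [Function.comp_apply, ← hγ ht, ← hγ hx.2, ← hγ hy.2] using hK hx.1 hy.1

theorem IsLipschitzCurve.trans (h₁ : IsLipschitzCurve n γ a b) (h₂ : IsLipschitzCurve n γ b c)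
    (hab : a ≤ b) (hbc : b ≤ c) : IsLipschitzCurve n γ a c := by
  have hunion : Icc a c = Icc a b ∪ Icc b c := (Icc_union_Icc_eq_Icc hab hbc).symm
  refine ⟨hunion ▸ h₁.1.union_of_isClosed h₂.1 isClosed_Icc isClosed_Icc, fun t ht => ?_⟩
  rcases lt_trichotomy t b with htb | rfl | htb
  · have : 𝓝[Icc a c] t = 𝓝[Icc a b] t := nhdsWithin_eq_nhdsWithin (mem_Iio.2 htb) isOpen_Iio <| by
      grind
    rw [this]
    exact h₁.2 t ⟨ht.1, htb.le⟩
  · have ht₁ : t ∈ Icc a t := right_mem_Icc.2 hab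
    have ht₂ : t ∈ Icc t c := left_mem_Icc.2 hbc
    obtain ⟨K₁, s₁, hs₁, hK₁⟩ := h₁.2 t ht₁
    obtain ⟨K₂, s₂, hs₂, hK₂⟩ := h₂.2 t ht₂
    refine ⟨max K₁ K₂, s₁ ∩ Icc a t ∪ s₂ ∩ Icc t c, ?_,
      lipschitzOnWith_union_of_le (fun x hx => hx.2.2) (fun x hx => hx.2.1)
        ⟨mem_of_mem_nhdsWithin ht₁ hs₁, ht₁⟩ ⟨mem_of_mem_nhdsWithin ht₂ hs₂, ht₂⟩
        (hK₁.mono inter_subset_left) (hK₂.mono inter_subset_left)⟩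
    rw [hunion, nhdsWithin_union]
    exact union_mem_sup (inter_mem hs₁ self_mem_nhdsWithin) (inter_mem hs₂ self_mem_nhdsWithin)
  · have : 𝓝[Icc a c] t = 𝓝[Icc b c] t := nhdsWithin_eq_nhdsWithin (mem_Ioi.2 htb) isOpen_Ioi <| by
      grind
    rw [this]
    exact h₂.2 t ⟨htb.le, ht.2⟩

theorem IsTimelikeCurve.congr (h : IsTimelikeCurve g X γ a b) (hγ : EqOn γ γ' (Icc a b)) :
    IsTimelikeCurve g X γ' a b := by
  obtain ⟨hab, hl, ε, hε, hv⟩ := h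
  refine ⟨hab, hl.congr hγ, ε, hε, ?_⟩
  filter_upwards [hv, ae_restrict_mem measurableSet_Ioo] with t htv ht
  have heq : γ =ᶠ[𝓝 t] γ' := eventually_of_mem (Icc_mem_nhds ht.1 ht.2) hγ
  have htransport : ∀ (x x' : N) (v v' : Coord n), x = x' → v = v' →
      (IsFutureTimelike g X x v ∧ g x v v < -ε) → IsFutureTimelike g X x' v' ∧ g x' v' v' < -ε := by
    rintro x _ v _ rfl rfl h
    exact h
  exact htransport _ _ _ _ heq.self_of_nhds
    (congrArg (fun L : ℝ →L[ℝ] Coord n => L 1) heq.mfderiv_eq) htv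

theorem IsTimelikeCurve.trans (h₁ : IsTimelikeCurve g X γ a b) (h₂ : IsTimelikeCurve g X γ b c) :
    IsTimelikeCurve g X γ a c := by
  obtain ⟨hab, hl₁, ε₁, hε₁, hv₁⟩ := h₁
  obtain ⟨hbc, hl₂, ε₂, hε₂, hv₂⟩ := h₂
  refine ⟨hab.trans hbc, hl₁.trans hl₂ hab.le hbc.le, min ε₁ ε₂, lt_min hε₁ hε₂, ?_⟩
  rw [ae_restrict_iff' measurableSet_Ioo] at hv₁ hv₂ ⊢
  filter_upwards [hv₁, hv₂, Measure.ae_ne volume b] with t h₁ h₂ htb ht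
  rcases lt_or_gt_of_ne htb with htb | htb
  · exact ⟨(h₁ ⟨ht.1, htb⟩).1, (h₁ ⟨ht.1, htb⟩).2.trans_le (neg_le_neg (min_le_left _ _))⟩
  · exact ⟨(h₂ ⟨htb, ht.2⟩).1, (h₂ ⟨htb, ht.2⟩).2.trans_le (neg_le_neg (min_le_right _ _))⟩

theorem IsTimelikeCurve.concat (h₁ : IsTimelikeCurve g X γ a b) (h₂ : IsTimelikeCurve g X γ' b c)
    (hb : γ b = γ' b) : IsTimelikeCurve g X (fun t => if t ≤ b then γ t else γ' t) a c := by
  refine (h₁.congr fun t ht => (if_pos ht.2).symm).trans (h₂.congr fun t ht => ?_)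
  rcases ht.1.eq_or_lt with rfl | hbt
  · rw [if_pos le_rfl, hb]
  · exact (if_neg hbt.not_ge).symm

variable {e : OpenPartialHomeomorph N (Coord n)} {w : ℝ → Coord n}

theorem chartVec_velocity_symm_comp (he : IsSmoothChart e) {t : ℝ} (hw : DifferentiableAt ℝ w t)
    (ht : w t ∈ e.target) :
    chartVec e (e.symm (w t)) (velocity (fun t => e.symm (w t)) t) = deriv w t := by
  have hcomp : velocity (fun t => e.symm (w t)) t =
      mfderiv (𝓡 (n + 1)) (𝓡 (n + 1)) e.symm (w t) (deriv w t) := by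
    have := ((he.mdifferentiable.mdifferentiableAt_symm ht).hasMFDerivAt.comp t
      hw.hasFDerivAt.hasMFDerivAt).mfderiv
    exact congrArg (fun L : ℝ →L[ℝ] Coord n => L 1) this
  rw [hcomp]
  exact congrArg (fun L => L (deriv w t)) (he.mdifferentiable.comp_symm_deriv ht)

variable [IsManifold (𝓡 (n + 1)) ∞ N]

theorem isTimelikeCurve_symm_comp (he : IsSmoothChart e) (hw : ContDiff ℝ ∞ w) (hab : a < b)
    (hmem : ∀ t ∈ Icc a b, w t ∈ e.target) {ε : ℝ} (hε : 0 < ε)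
    (hself : ∀ t ∈ Icc a b, chartForm g e (w t) (deriv w t) (deriv w t) < -ε)
    (hfut : ∀ t ∈ Icc a b,
      chartForm g e (w t) (chartVec e (e.symm (w t)) (X (e.symm (w t)))) (deriv w t) < 0) :
    IsTimelikeCurve g X (fun t => e.symm (w t)) a b := by
  have hsm : ∀ t ∈ Icc a b, ContMDiffAt 𝓘(ℝ, ℝ) (𝓡 (n + 1)) ∞ (fun t => e.symm (w t)) t :=
    fun t ht => ContMDiffAt.comp t (contMDiffAt_symm_of_mem_maximalAtlas he (hmem t ht))
      hw.contMDiff.contMDiffAt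
  refine ⟨hab, ⟨fun t ht => (hsm t ht).continuousAt.continuousWithinAt, fun t ht => ?_⟩,
    ε, hε, ?_⟩
  · have h : ContMDiffAt 𝓘(ℝ, ℝ) (𝓡 (n + 1)) ∞
        (chartAt (Coord n) (e.symm (w t)) ∘ fun t => e.symm (w t)) t :=
      ContMDiffAt.comp t (contMDiffAt_of_mem_maximalAtlas
        (IsManifold.chart_mem_maximalAtlas _) (mem_chart_source _ _)) (hsm t ht)
    obtain ⟨K, s, hs, hK⟩ := (h.contDiffAt.of_le (by simp)).exists_lipschitzOnWith
    exact ⟨K, s, mem_nhdsWithin_of_mem_nhds hs, hK⟩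
  · filter_upwards [ae_restrict_mem measurableSet_Ioo] with t ht
    have ht' := Ioo_subset_Icc_self ht
    rw [IsFutureTimelike, apply_eq_chartForm g he (hmem t ht'),
      apply_eq_chartForm g he (hmem t ht'),
      chartVec_velocity_symm_comp he (hw.differentiable (by simp) t) (hmem t ht')]
    exact ⟨⟨(hself t ht').trans (neg_neg_of_pos hε), hfut t ht'⟩, hself t ht'⟩

end Curves

theorem exists_eqOn_of_pairwise_eqOn {ι α β : Type*} [Nonempty ι] {f : ι → α → β} {s : ι → Set α}
    (h : ∀ i j, EqOn (f i) (f j) (s i ∩ s j)) : ∃ F : α → β, ∀ i, EqOn F (f i) (s i) := by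
  classical
  refine ⟨fun x => if hx : ∃ i, x ∈ s i then f hx.choose x else f (Classical.arbitrary ι) x,
    fun i x hxi => ?_⟩
  have hx : ∃ i, x ∈ s i := ⟨i, hxi⟩
  simp only [dif_pos hx]
  exact h _ _ ⟨hx.choose_spec, hxi⟩

/-- The extension order on curves `c = (γ, J)`, where `γ` only matters on the interval `J`. -/
def CurveExtends {N : Type*} (c d : (ℝ → N) × Set ℝ) : Prop :=
  c.2 ⊆ d.2 ∧ EqOn d.1 c.1 c.2

theorem CurveExtends.trans {N : Type*} {c d f : (ℝ → N) × Set ℝ} (hcd : CurveExtends c d)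
    (hdf : CurveExtends d f) : CurveExtends c f :=
  ⟨hcd.1.trans hdf.1, (hdf.2.mono hcd.1).trans hcd.2⟩

section IntegralCurves

variable {n : ℕ} {N : Type*} [TopologicalSpace N] [ChartedSpace (Coord n) N]
  {u : VecField n N} {M : Set N}

theorem isMIntegralCurveAt_congr {γ γ' : ℝ → N} {t : ℝ} (hγ : IsMIntegralCurveAt γ u t)
    (h : γ' =ᶠ[𝓝 t] γ) : IsMIntegralCurveAt γ' u t := by
  filter_upwards [hγ, eventually_eventually_nhds.2 h] with s hs heq
  have hvel : (u (γ' s) : Coord n) = u (γ s) :=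
    congrArg (fun x => (u x : Coord n)) heq.self_of_nhds
  change HasMFDerivAt 𝓘(ℝ, ℝ) (𝓡 (n + 1)) γ' s ((1 : ℝ →L[ℝ] ℝ).smulRight (u (γ' s) : Coord n))
  rw [hvel]
  exact hs.congr_of_eventuallyEq heq

theorem isIntegralCurveIn_iUnion {ι : Type*} [Nonempty ι] {γ : ι → ℝ → N} {J : ι → Set ℝ}
    {Γ : ℝ → N} {t₀ : ℝ} (h : ∀ i, IsIntegralCurveIn u M (γ i) (J i)) (ht₀ : ∀ i, t₀ ∈ J i)
    (hΓ : ∀ i, EqOn Γ (γ i) (J i)) : IsIntegralCurveIn u M Γ (⋃ i, J i) := by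
  have hopen := fun i => (h i).1
  refine ⟨isOpen_iUnion hopen, ⟨t₀, mem_iUnion.2 ⟨Classical.arbitrary ι, ht₀ _⟩⟩,
    (isPreconnected_iUnion ⟨t₀, mem_iInter.2 ht₀⟩
      fun i => (h i).2.2.1.isPreconnected).ordConnected,
    mapsTo_iUnion.2 fun i => (h i).2.2.2.1.congr (hΓ i).symm, ?_⟩
  refine (isMIntegralCurveOn_iff_isMIntegralCurveAt (isOpen_iUnion hopen)).2 fun t ht => ?_
  obtain ⟨i, hi⟩ := mem_iUnion.1 ht
  have hnhds := (hopen i).mem_nhds hi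
  exact isMIntegralCurveAt_congr ((h i).2.2.2.2.isMIntegralCurveAt hnhds)
    (eventually_of_mem hnhds (hΓ i))

theorem IsIntegralCurveIn.exists_isMaximalIntegralCurveIn {γ : ℝ → N} {J : Set ℝ}
    (h : IsIntegralCurveIn u M γ J) :
    ∃ γ' J', IsMaximalIntegralCurveIn u M γ' J' ∧ CurveExtends (γ, J) (γ', J') := by
  let A := {c : (ℝ → N) × Set ℝ // IsIntegralCurveIn u M c.1 c.2 ∧ CurveExtends (γ, J) c}
  have : Nonempty A := ⟨⟨(γ, J), h, Subset.rfl, eqOn_refl _ _⟩⟩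
  obtain ⟨m, hm⟩ : ∃ m : A, ∀ d : A, CurveExtends m.1 d.1 → CurveExtends d.1 m.1 := by
    refine exists_maximal_of_nonempty_chains_bounded (fun C hC hne => ?_)
      fun h₁ h₂ => h₁.trans h₂
    have := hne.to_subtype
    obtain ⟨Γ, hΓ⟩ := exists_eqOn_of_pairwise_eqOn (ι := C) (f := fun d => d.1.1.1)
      (s := fun d => d.1.1.2) fun c d t ht => by
        rcases eq_or_ne c.1 d.1 with heq | hne
        · rw [heq]
        · rcases hC c.2 d.2 hne with hcd | hdc
          · exact (hcd.2 ht.1).symm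
          · exact hdc.2 ht.2
    obtain ⟨t₀, ht₀⟩ := h.2.1
    obtain ⟨d₀, hd₀⟩ := hne
    refine ⟨⟨(Γ, ⋃ d : C, d.1.1.2),
      isIntegralCurveIn_iUnion (fun d : C => d.1.2.1) (fun d => d.1.2.2.1 ht₀) hΓ, ?_⟩,
      fun d hd => ⟨subset_iUnion (fun d : C => d.1.1.2) ⟨d, hd⟩, hΓ ⟨d, hd⟩⟩⟩
    exact d₀.2.2.trans ⟨subset_iUnion (fun d : C => d.1.1.2) ⟨d₀, hd₀⟩, hΓ ⟨d₀, hd₀⟩⟩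
  exact ⟨m.1.1, m.1.2, ⟨m.2.1, fun γ' J' h' hJ hE =>
    (hm ⟨(γ', J'), h', m.2.2.trans ⟨hJ, hE⟩⟩ ⟨hJ, hE⟩).1.antisymm hJ⟩, m.2.2⟩

variable [IsManifold (𝓡 (n + 1)) ∞ N]

theorem exists_isIntegralCurveIn (hM : IsOpen M) {q : N} (hq : q ∈ M)
    (hu : ContMDiffAt (𝓡 (n + 1)) (𝓡 (n + 1)).tangent 1
      (fun x => (⟨x, u x⟩ : TangentBundle (𝓡 (n + 1)) N)) q) (t₀ : ℝ) :
    ∃ γ J, IsIntegralCurveIn u M γ J ∧ t₀ ∈ J ∧ γ t₀ = q := by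
  have : IsManifold (𝓡 (n + 1)) 1 N := IsManifold.of_le (n := ∞) (by simp)
  obtain ⟨γ, hγ, hint⟩ := exists_isMIntegralCurveAt_of_contMDiffAt_boundaryless (t₀ := t₀) hu
  have hmem : ∀ᶠ t in 𝓝 t₀, γ t ∈ M :=
    hint.continuousAt.eventually (hM.mem_nhds (hγ.symm ▸ hq))
  obtain ⟨ε, hε, hball⟩ := Metric.eventually_nhds_iff_ball.1 (hmem.and hint)
  exact ⟨γ, Metric.ball t₀ ε, ⟨Metric.isOpen_ball, Metric.nonempty_ball.2 hε,
    (convex_ball _ _).ordConnected, fun t ht => (hball t ht).1,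
    fun t ht => (hball t ht).2.hasMFDerivWithinAt⟩, Metric.mem_ball_self hε, hγ⟩

theorem exists_isMaximalIntegralCurveIn (hM : IsOpen M) {q : N} (hq : q ∈ M)
    (hu : ContMDiffAt (𝓡 (n + 1)) (𝓡 (n + 1)).tangent 1
      (fun x => (⟨x, u x⟩ : TangentBundle (𝓡 (n + 1)) N)) q) (t₀ : ℝ) :
    ∃ γ J, IsMaximalIntegralCurveIn u M γ J ∧ t₀ ∈ J ∧ γ t₀ = q := by
  obtain ⟨γ, J, h, ht₀, hγ⟩ := exists_isIntegralCurveIn hM hq hu t₀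
  obtain ⟨γ', J', hmax, hsub, heq⟩ := h.exists_isMaximalIntegralCurveIn
  exact ⟨γ', J', hmax, hsub ht₀, (heq ht₀).trans hγ⟩

end IntegralCurves

theorem tendsto_matrix_inv {ι α : Type*} [Fintype ι] [DecidableEq ι] {l : Filter α}
    {A : α → Matrix ι ι ℝ} {B : Matrix ι ι ℝ} (h : Tendsto A l (𝓝 B)) (hB : B.det ≠ 0) :
    Tendsto (fun a => (A a)⁻¹) l (𝓝 B⁻¹) := by
  simp only [Matrix.inv_def, Ring.inverse_eq_inv']
  have hdet : Tendsto (fun a => (A a).det) l (𝓝 B.det) :=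
    (continuous_id.matrix_det.tendsto B).comp h
  have hadj : Tendsto (fun a => (A a).adjugate) l (𝓝 B.adjugate) :=
    (continuous_id.matrix_adjugate.tendsto B).comp h
  exact (hdet.inv₀ hB).smul hadj

theorem tendsto_mulVec {m ι α : Type*} [Fintype ι] {l : Filter α} {A : α → Matrix m ι ℝ}
    {v : α → ι → ℝ} {B : Matrix m ι ℝ} {w : ι → ℝ} (hA : Tendsto A l (𝓝 B))
    (hv : Tendsto v l (𝓝 w)) : Tendsto (fun a => (A a).mulVec (v a)) l (𝓝 (B.mulVec w)) :=
  ((continuous_fst.matrix_mulVec continuous_snd).tendsto (B, w)).comp (hA.prodMk_nhds hv)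

theorem tendsto_dotProduct {ι α : Type*} [Fintype ι] {l : Filter α} {v w : α → ι → ℝ}
    {v₀ w₀ : ι → ℝ} (hv : Tendsto v l (𝓝 v₀)) (hw : Tendsto w l (𝓝 w₀)) :
    Tendsto (fun a => v a ⬝ᵥ w a) l (𝓝 (v₀ ⬝ᵥ w₀)) :=
  ((continuous_fst.dotProduct continuous_snd).tendsto (v₀, w₀)).comp (hv.prodMk_nhds hw)

theorem tendsto_of_tendsto_mulVec {ι α : Type*} [Fintype ι] [DecidableEq ι] {l : Filter α}
    {A : α → Matrix ι ι ℝ} {B : Matrix ι ι ℝ} {v : α → ι → ℝ} {w : ι → ℝ}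
    (hA : Tendsto A l (𝓝 B)) (hB : B.det ≠ 0)
    (h : Tendsto (fun a => (A a).mulVec (v a)) l (𝓝 w)) : Tendsto v l (𝓝 (B⁻¹.mulVec w)) := by
  have hdet : ∀ᶠ a in l, (A a).det ≠ 0 :=
    ((continuous_id.matrix_det.tendsto B).comp hA).eventually_ne hB
  refine (tendsto_mulVec (tendsto_matrix_inv hA hB) h).congr' ?_
  filter_upwards [hdet] with a ha
  rw [Matrix.mulVec_mulVec, Matrix.nonsing_inv_mul _ ha.isUnit, Matrix.one_mulVec]

/-- If `θ ⊗ θ` converges, then so does `θ`, as soon as its sign is fixed by pairing it with a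
convergent `Y`. -/
theorem exists_tendsto_of_tendsto_vecMulVec {ι α : Type*} [Fintype ι] {l : Filter α}
    {θ Y : α → ι → ℝ} {A : Matrix ι ι ℝ} {Y₀ : ι → ℝ}
    (hA : Tendsto (fun a => Matrix.vecMulVec (θ a) (θ a)) l (𝓝 A)) (hY : Tendsto Y l (𝓝 Y₀))
    (hneg : ∀ᶠ a in l, Y a ⬝ᵥ θ a < 0) (hpos : 0 < Y₀ ⬝ᵥ A.mulVec Y₀) :
    ∃ θ₀, Tendsto θ l (𝓝 θ₀) ∧ Y₀ ⬝ᵥ θ₀ < 0 := by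
  have hAY : Tendsto (fun a => (Y a ⬝ᵥ θ a) • θ a) l (𝓝 (A.mulVec Y₀)) :=
    (tendsto_mulVec hA hY).congr fun a => by
      rw [Matrix.vecMulVec_mulVec, op_smul_eq_smul, dotProduct_comm]
  have hsq : Tendsto (fun a => (Y a ⬝ᵥ θ a) ^ 2) l (𝓝 (Y₀ ⬝ᵥ A.mulVec Y₀)) :=
    (tendsto_dotProduct hY hAY).congr fun a => by rw [dotProduct_smul, smul_eq_mul, sq]
  have hpair : Tendsto (fun a => Y a ⬝ᵥ θ a) l (𝓝 (-√(Y₀ ⬝ᵥ A.mulVec Y₀))) := by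
    refine hsq.sqrt.neg.congr' ?_
    filter_upwards [hneg] with a ha
    rw [Real.sqrt_sq_eq_abs, abs_of_neg ha, neg_neg]
  have hlim_neg : -√(Y₀ ⬝ᵥ A.mulVec Y₀) < 0 := neg_neg_of_pos (Real.sqrt_pos.2 hpos)
  have hθ : Tendsto θ l (𝓝 ((-√(Y₀ ⬝ᵥ A.mulVec Y₀))⁻¹ • A.mulVec Y₀)) := by
    refine ((hpair.inv₀ hlim_neg.ne).smul hAY).congr' ?_
    filter_upwards [hneg] with a ha
    exact inv_smul_smul₀ ha.ne _
  refine ⟨_, hθ, ?_⟩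
  rw [dotProduct_smul, smul_eq_mul]
  exact mul_neg_of_neg_of_pos (inv_lt_zero.2 hlim_neg) hpos

section Limits

variable {n : ℕ} {N : Type*} [TopologicalSpace N] [ChartedSpace (Coord n) N]
  {g : Tensor2 n N} {X u : VecField n N} {M : Set N} {e : OpenPartialHomeomorph N (Coord n)} {O : N}

theorem apply_eq_chartForm_of_mem_source (T : Tensor2 n N) (he : IsSmoothChart e) {x : N}
    (hx : x ∈ e.source) (v w : TangentSpace (𝓡 (n + 1)) x) :
    T x v w = chartForm T e (e x) (chartVec e x v) (chartVec e x w) := by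
  obtain ⟨y, hy, rfl⟩ : ∃ y ∈ e.target, e.symm y = x := ⟨e x, e.map_source hx, e.left_inv hx⟩
  rw [e.right_inv hy]
  exact apply_eq_chartForm T he hy v w

variable [IsManifold (𝓡 (n + 1)) ∞ N]

theorem continuousOn_chartVec (he : IsSmoothChart e)
    (hX : Continuous fun x => (⟨x, X x⟩ : TangentBundle (𝓡 (n + 1)) N)) :
    ContinuousOn (fun x => chartVec e x (X x)) e.source := by
  have hmap : ContinuousOn (tangentMapWithin (𝓡 (n + 1)) (𝓡 (n + 1)) e e.source) _ :=
    (contMDiffOn_of_mem_maximalAtlas he).continuousOn_tangentMapWithin (by simp)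
      e.open_source.uniqueMDiffOn
  have hsnd := (continuous_snd (X := Coord n) (Y := Coord n)).comp_continuousOn
    (((tangentBundleModelSpaceHomeomorph (𝓡 (n + 1))).continuous.comp_continuousOn hmap).comp
      hX.continuousOn (s := e.source) (fun x hx => hx))
  refine hsnd.congr fun x hx => ?_
  change mfderiv (𝓡 (n + 1)) (𝓡 (n + 1)) e x (X x) =
    mfderivWithin (𝓡 (n + 1)) (𝓡 (n + 1)) e e.source x (X x)
  rw [mfderivWithin_of_isOpen e.open_source hx]

theorem IsContinuousSpacetime.continuousAt_compMatrix (hg : IsContinuousSpacetime g X)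
    (he : IsSmoothChart e) {y : Coord n} (hy : y ∈ e.target) : ContinuousAt (compMatrix g e) y :=
  (continuousOn_pi.2 fun i => continuousOn_pi.2 fun j => hg.continuous_metric e he i j).continuousAt
    (e.open_target.mem_nhds hy)

theorem IsContinuousSpacetime.tendsto_chartForm (hg : IsContinuousSpacetime g X)
    (he : IsSmoothChart e) {α : Type*} {l : Filter α} {y v w : α → Coord n} {y₀ v₀ w₀ : Coord n}
    (hy₀ : y₀ ∈ e.target) (hy : Tendsto y l (𝓝 y₀)) (hv : Tendsto v l (𝓝 v₀))
    (hw : Tendsto w l (𝓝 w₀)) :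
    Tendsto (fun a => chartForm g e (y a) (v a) (w a)) l (𝓝 (chartForm g e y₀ v₀ w₀)) :=
  have hofLp := PiLp.continuous_ofLp 2 fun _ : Fin (n + 1) => ℝ
  tendsto_dotProduct ((hofLp.tendsto v₀).comp hv) (tendsto_mulVec
    ((hg.continuousAt_compMatrix he hy₀).tendsto.comp hy) ((hofLp.tendsto w₀).comp hw))

theorem IsContinuousSpacetime.pos_of_tendsto_vecMulVec (hg : IsContinuousSpacetime g X)
    (he : IsSmoothChart e) (hO : O ∈ e.source) [NeBot (𝓝[M] O)]
    (hunit : ∀ x ∈ M, g x (u x) (u x) = -1) {A : Matrix (Fin (n + 1)) (Fin (n + 1)) ℝ}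
    (hA : Tendsto (fun x => Matrix.vecMulVec
      ((compMatrix g e (e x)).mulVec (chartVec e x (u x)).ofLp)
      ((compMatrix g e (e x)).mulVec (chartVec e x (u x)).ofLp)) (𝓝[M] O) (𝓝 A)) :
    0 < (chartVec e O (X O)).ofLp ⬝ᵥ A.mulVec (chartVec e O (X O)).ofLp := by
  have he_lim : Tendsto e (𝓝[M] O) (𝓝 (e O)) := (e.continuousAt hO).continuousWithinAt
  have hX : Tendsto (fun x => chartVec e x (X x)) (𝓝[M] O) (𝓝 (chartVec e O (X O))) :=
    ((continuousOn_chartVec he hg.continuous_orientation).continuousAt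
      (e.open_source.mem_nhds hO)).continuousWithinAt
  have hX' := ((PiLp.continuous_ofLp 2 _).tendsto _).comp hX
  refine lt_of_lt_of_le (neg_pos.2 (hg.timelike_orientation O)) ?_
  rw [apply_eq_chartForm_of_mem_source g he hO]
  refine le_of_tendsto_of_tendsto
    (hg.tendsto_chartForm he (e.map_source hO) he_lim hX hX).neg
    (tendsto_dotProduct hX' (tendsto_mulVec hA hX')) ?_
  filter_upwards [nhdsWithin_le_nhds (e.open_source.mem_nhds hO), self_mem_nhdsWithin]
    with x hxe hxM
  have hCS := (hg.lorentz x).mul_le_sq (hg.timelike_orientation x) (w := u x)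
  rw [hunit x hxM, apply_eq_chartForm_of_mem_source g he hxe (X x) (u x),
    apply_eq_chartForm_of_mem_source g he hxe] at hCS
  simp only [Function.comp_apply, Matrix.vecMulVec_mulVec, op_smul_eq_smul, dotProduct_smul,
    smul_eq_mul]
  rw [dotProduct_comm (Matrix.mulVec _ _), ← sq]
  rwa [mul_neg_one] at hCS

theorem IsContinuousSpacetime.exists_tendsto_chartVec (hg : IsContinuousSpacetime g X)
    (he : IsSmoothChart e) (hO : O ∈ e.source) [NeBot (𝓝[M] O)]
    (hunit : ∀ x ∈ M, g x (u x) (u x) = -1) (hfut : ∀ x ∈ M, IsFutureTimelike g X x (u x))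
    {A : Matrix (Fin (n + 1)) (Fin (n + 1)) ℝ}
    (hA : Tendsto (fun x => Matrix.vecMulVec
      ((compMatrix g e (e x)).mulVec (chartVec e x (u x)).ofLp)
      ((compMatrix g e (e x)).mulVec (chartVec e x (u x)).ofLp)) (𝓝[M] O) (𝓝 A)) :
    ∃ U : Coord n, Tendsto (fun x => chartVec e x (u x)) (𝓝[M] O) (𝓝 U) ∧
      chartForm g e (e O) U U = -1 ∧ chartForm g e (e O) (chartVec e O (X O)) U < 0 := by
  have hev : ∀ᶠ x in 𝓝[M] O, x ∈ e.source ∧ x ∈ M :=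
    eventually_of_mem (inter_mem (nhdsWithin_le_nhds (e.open_source.mem_nhds hO))
      self_mem_nhdsWithin) fun _ h => h
  have hOe := e.map_source hO
  have he_lim : Tendsto e (𝓝[M] O) (𝓝 (e O)) := (e.continuousAt hO).continuousWithinAt
  have hX : Tendsto (fun x => chartVec e x (X x)) (𝓝[M] O) (𝓝 (chartVec e O (X O))) :=
    ((continuousOn_chartVec he hg.continuous_orientation).continuousAt
      (e.open_source.mem_nhds hO)).continuousWithinAt
  have hneg : ∀ᶠ x in 𝓝[M] O, (chartVec e x (X x)).ofLp ⬝ᵥ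
      (compMatrix g e (e x)).mulVec (chartVec e x (u x)).ofLp < 0 := by
    filter_upwards [hev] with x ⟨hxe, hxM⟩
    exact (apply_eq_chartForm_of_mem_source g he hxe _ _).symm.trans_lt (hfut x hxM).2
  obtain ⟨θ, hθ, hθ_neg⟩ := exists_tendsto_of_tendsto_vecMulVec hA
    (((PiLp.continuous_ofLp 2 _).tendsto _).comp hX) hneg
    (hg.pos_of_tendsto_vecMulVec he hO hunit hA)
  have hdet := det_compMatrix_ne_zero hg.lorentz he hOe
  have hU : Tendsto (fun x => chartVec e x (u x)) (𝓝[M] O)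
      (𝓝 (WithLp.toLp 2 ((compMatrix g e (e O))⁻¹.mulVec θ))) :=
    ((PiLp.continuous_toLp 2 _).tendsto _).comp
      (tendsto_of_tendsto_mulVec ((hg.continuousAt_compMatrix he hOe).tendsto.comp he_lim) hdet hθ)
  refine ⟨_, hU, tendsto_nhds_unique (hg.tendsto_chartForm he hOe he_lim hU hU) ?_, ?_⟩
  · refine tendsto_const_nhds.congr' ?_
    filter_upwards [hev] with x ⟨hxe, hxM⟩
    rw [← apply_eq_chartForm_of_mem_source g he hxe, hunit x hxM]
  · rwa [chartForm, Matrix.mulVec_mulVec, Matrix.mul_nonsing_inv _ hdet.isUnit,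
      Matrix.one_mulVec]

end Limits

section TimelikeCone

variable {n : ℕ} {N : Type*} [TopologicalSpace N] [ChartedSpace (Coord n) N]
  {g : Tensor2 n N} {X : VecField n N} {e : OpenPartialHomeomorph N (Coord n)}

/-- In the chart `e`, all the directions in `C` are future directed timelike at all the points with
coordinates in `K`, uniformly in both. -/
def IsTimelikeCone (g : Tensor2 n N) (X : VecField n N) (e : OpenPartialHomeomorph N (Coord n))
    (K C : Set (Coord n)) : Prop :=
  K ⊆ e.target ∧ ∃ ε > 0, ∀ y ∈ K, ∀ w ∈ C, chartForm g e y w w < -ε ∧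
    chartForm g e y (chartVec e (e.symm y) (X (e.symm y))) w < 0

variable {K K' C : Set (Coord n)}

theorem IsTimelikeCone.mono (h : IsTimelikeCone g X e K C) (hK : K' ⊆ K) :
    IsTimelikeCone g X e K' C := by
  obtain ⟨ht, ε, hε, hw⟩ := h
  exact ⟨hK.trans ht, ε, hε, fun y hy => hw y (hK hy)⟩

variable [IsManifold (𝓡 (n + 1)) ∞ N]

theorem IsContinuousSpacetime.exists_isTimelikeCone (hg : IsContinuousSpacetime g X)
    (he : IsSmoothChart e) {O : N} (hO : O ∈ e.source) {U : Coord n}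
    (hself : chartForm g e (e O) U U < 0)
    (hfut : chartForm g e (e O) (chartVec e O (X O)) U < 0) :
    ∃ K ∈ 𝓝 (e O), ∃ δ > 0, IsTimelikeCone g X e K (Metric.ball U δ) := by
  have hOe := e.map_source hO
  obtain ⟨ε, hUε, hε⟩ := exists_between hself
  have hX : Tendsto (fun y => chartVec e (e.symm y) (X (e.symm y))) (𝓝 (e O))
      (𝓝 (chartVec e O (X O))) :=
    ((continuousOn_chartVec he hg.continuous_orientation).continuousAt
      (e.open_source.mem_nhds hO)).tendsto.comp (e.tendsto_symm hO)
  have htime : ∀ᶠ q : Coord n × Coord n in 𝓝 (e O) ×ˢ 𝓝 U, chartForm g e q.1 q.2 q.2 < ε ∧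
      chartForm g e q.1 (chartVec e (e.symm q.1) (X (e.symm q.1))) q.2 < 0 :=
    ((hg.tendsto_chartForm he hOe tendsto_fst tendsto_snd tendsto_snd).eventually_lt_const hUε).and
      ((hg.tendsto_chartForm he hOe tendsto_fst (hX.comp tendsto_fst)
        tendsto_snd).eventually_lt_const hfut)
  obtain ⟨P, hP, Q, hQ, hPQ⟩ := eventually_prod_iff.1 htime
  obtain ⟨δ, hδ, hδQ⟩ := Metric.eventually_nhds_iff_ball.1 hQ
  refine ⟨e.target ∩ {y | P y}, inter_mem (e.open_target.mem_nhds hOe) hP, δ, hδ,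
    inter_subset_left, -ε, neg_pos.2 hε, fun y hy w hw => ?_⟩
  rw [neg_neg]
  exact hPQ hy.2 (hδQ w hw)

variable {y w : Coord n} {T : ℝ}

theorem IsTimelikeCone.isTimelikeCurve_segment (h : IsTimelikeCone g X e K C)
    (he : IsSmoothChart e) (hK : Convex ℝ K) (hy : y ∈ K) (hw : w ∈ C) (hT : 0 < T)
    (hyw : y + T • w ∈ K) (a : ℝ) :
    IsTimelikeCurve g X (fun t => e.symm (y + (t - a) • w)) a (a + T) := by
  obtain ⟨htarget, ε, hε, hcone⟩ := h
  have hmem : ∀ t ∈ Icc a (a + T), y + (t - a) • w ∈ K := by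
    intro t ht
    have h := hK.add_smul_sub_mem hy hyw (t := (t - a) / T)
      ⟨div_nonneg (by linarith [ht.1]) hT.le, (div_le_one hT).2 (by linarith [ht.2])⟩
    rwa [add_sub_cancel_left, smul_smul, div_mul_cancel₀ _ hT.ne'] at h
  have hderiv : ∀ t, deriv (fun t : ℝ => y + (t - a) • w) t = w := fun t => by
    simpa using ((((hasDerivAt_id t).sub_const a).smul_const w).const_add y).deriv
  refine isTimelikeCurve_symm_comp he (by fun_prop) (lt_add_of_pos_right a hT)
    (fun t ht => htarget (hmem t ht)) hε (fun t ht => ?_) (fun t ht => ?_) <;> rw [hderiv]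
  · exact (hcone _ (hmem t ht) w hw).1
  · exact (hcone _ (hmem t ht) w hw).2

theorem IsTimelikeCone.add_smul_mem_timelikeFuture (h : IsTimelikeCone g X e K C)
    (he : IsSmoothChart e) (hK : Convex ℝ K) (hy : y ∈ K) (hw : w ∈ C) (hT : 0 < T)
    (hyw : y + T • w ∈ K) : e.symm (y + T • w) ∈ timelikeFuture g X (e.symm y) univ :=
  ⟨_, 0, 0 + T, h.isTimelikeCurve_segment he hK hy hw hT hyw 0, mapsTo_univ _ _, by simp, by simp⟩

theorem IsTimelikeCone.add_smul_mem_timelikeFuture_of_mem (h : IsTimelikeCone g X e K C)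
    (he : IsSmoothChart e) (hK : Convex ℝ K) {x : N} (hx : e.symm y ∈ timelikeFuture g X x univ)
    (hy : y ∈ K) (hw : w ∈ C) (hT : 0 < T) (hyw : y + T • w ∈ K) :
    e.symm (y + T • w) ∈ timelikeFuture g X x univ := by
  obtain ⟨γ, a, b, hγ, -, hγa, hγb⟩ := hx
  refine ⟨_, a, b + T, hγ.concat (h.isTimelikeCurve_segment he hK hy hw hT hyw b) ?_,
    mapsTo_univ _ _, ?_, ?_⟩
  · simp [hγb]
  · rw [if_pos hγ.1.le, hγa]
  · rw [if_neg (by linarith), add_sub_cancel_left]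

end TimelikeCone

theorem exists_norm_sub_lt_linearIndependent_pair {E : Type*} [NormedAddCommGroup E]
    [NormedSpace ℝ E] (hE : 1 < Module.finrank ℝ E) {x : E} (hx : x ≠ 0) {δ : ℝ} (hδ : 0 < δ) :
    ∃ y, ‖y - x‖ < δ ∧ LinearIndependent ℝ ![x, y] := by
  obtain ⟨z, hz⟩ := exists_linearIndependent_pair_of_one_lt_finrank hE hx
  have hz0 : 0 < ‖z‖ := norm_pos_iff.2 (hz.ne_zero 1)
  have hc : 0 < δ / (2 * ‖z‖) := by positivity
  refine ⟨x + (δ / (2 * ‖z‖)) • z, ?_, ?_⟩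
  · rw [add_sub_cancel_left, norm_smul, Real.norm_of_nonneg hc.le]
    calc δ / (2 * ‖z‖) * ‖z‖ = δ / 2 := by field_simp
      _ < δ := half_lt_self hδ
  · rw [LinearIndependent.pair_add_right_iff]
    simpa using (LinearIndependent.pair_smul_smul_iff isUnit_one hc.ne'.isUnit).2 hz

theorem exists_mul_abs_add_abs_le_norm_of_linearIndependent {E : Type*} [NormedAddCommGroup E]
    [NormedSpace ℝ E] {x y : E} (h : LinearIndependent ℝ ![x, y]) :
    ∃ κ > 0, ∀ s t : ℝ, κ * (|s| + |t|) ≤ ‖s • x + t • y‖ := by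
  let f : ℝ × ℝ →ₗ[ℝ] E :=
    (LinearMap.toSpanSingleton ℝ E x).coprod (LinearMap.toSpanSingleton ℝ E y)
  have hker : LinearMap.ker f = ⊥ := LinearMap.ker_eq_bot'.2 fun q hq =>
    Prod.ext_iff.2 (LinearIndependent.pair_iff.1 h q.1 q.2 (by simpa [f] using hq))
  obtain ⟨K, hK, hf⟩ := f.exists_antilipschitzWith hker
  refine ⟨(2 * (K : ℝ))⁻¹, by positivity, fun s t => ?_⟩
  have hle : max |s| |t| ≤ K * ‖s • x + t • y‖ := by
    simpa [f, Prod.norm_def, dist_zero_right] using hf.le_mul_dist (s, t) 0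
  rw [inv_mul_le_iff₀ (by positivity)]
  linarith [le_max_left |s| |t|, le_max_right |s| |t|]

/-- A path from `z` to `a` that is almost straight in the direction `U` and much longer than `a` is
distant from `c` also has its chord from `z` to `c` almost in the direction `U`. -/
theorem norm_inv_smul_sub_sub_lt {E : Type*} [NormedAddCommGroup E] [NormedSpace ℝ E]
    {a c z U : E} {T r δ ε : ℝ} (hT : 0 < T) (hεδ : ε < δ) (hz : r ≤ ‖z - c‖)
    (hpath : ‖a - z - T • U‖ ≤ ε * T) (ha : ‖a - c‖ * (‖U‖ + ε) < (δ - ε) * (r - ‖a - c‖)) :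
    ‖T⁻¹ • (c - z) - U‖ < δ := by
  have hTU : ‖T • U‖ = T * ‖U‖ := by rw [norm_smul, Real.norm_of_nonneg hT.le]
  have hε : 0 ≤ ε := nonneg_of_mul_nonneg_left ((norm_nonneg _).trans hpath) hT
  have hlong : r - ‖a - c‖ ≤ T * (‖U‖ + ε) := by
    have hsum : z - c = (a - c) - T • U - (a - z - T • U) := by module
    have := (norm_sub_le ((a - c) - T • U) (a - z - T • U)).trans
      (add_le_add_left (norm_sub_le _ _) _)
    rw [← hsum, hTU] at this
    linarith
  have hclose : ‖a - c‖ < (δ - ε) * T := by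
    refine lt_of_mul_lt_mul_right (a := ‖U‖ + ε) (ha.trans_le ?_) (by positivity)
    rw [mul_assoc]
    exact mul_le_mul_of_nonneg_left hlong (by linarith)
  have hscale : T⁻¹ • (c - z) - U = T⁻¹ • ((a - z - T • U) - (a - c)) := by
    rw [← sub_eq_zero, ← inv_smul_smul₀ hT.ne' U, ← smul_sub, ← smul_sub, smul_inv_smul₀ hT.ne']
    module
  rw [hscale, norm_smul, norm_inv, Real.norm_of_nonneg hT.le, inv_mul_lt_iff₀ hT]
  linarith [norm_sub_le (a - z - T • U) (a - c)]

theorem exists_pos_norm_smul_mul_lt {E : Type*} [NormedAddCommGroup E] [NormedSpace ℝ E] (v : E)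
    {r b : ℝ} (hr : 0 < r) (hb : 0 < b) (a : ℝ) :
    ∃ s : ℝ, 0 < s ∧ ‖s • v‖ < r ∧ ‖s • v‖ * a < b * (r - ‖s • v‖) := by
  have hcont : Continuous fun s : ℝ => ‖s • v‖ := by fun_prop
  have hlim : Tendsto (fun s : ℝ => ‖s • v‖) (𝓝[>] 0) (𝓝 0) := by
    simpa using (hcont.tendsto 0).mono_left nhdsWithin_le_nhds
  have hlt := (hlim.mul_const a).eventually_lt ((hlim.const_sub r).const_mul b)
    (by rw [zero_mul, sub_zero]; exact mul_pos hb hr)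
  exact (eventually_mem_nhdsWithin.and ((hlim.eventually_lt_const hr).and hlt)).exists

theorem exists_last_exit {Y : Type*} [TopologicalSpace Y] {γ : ℝ → Y} {a b : ℝ}
    (hγ : ContinuousOn γ (Icc a b)) {W : Set Y} (hW : IsOpen W) (hab : a ≤ b) (ha : γ a ∉ W)
    (hb : γ b ∈ W) : ∃ t ∈ Ico a b, γ t ∉ W ∧ ∀ s ∈ Icc t b, γ s ∈ closure W := by
  have hcompact : IsCompact (Icc a b ∩ γ ⁻¹' Wᶜ) := isCompact_Icc.of_isClosed_subset
    (hγ.preimage_isClosed_of_isClosed isClosed_Icc hW.isClosed_compl) inter_subset_left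
  obtain ⟨t, ⟨ht, htW⟩, hmax⟩ := hcompact.exists_isGreatest ⟨a, left_mem_Icc.2 hab, ha⟩
  have htb : t < b := lt_of_le_of_ne ht.2 fun h => htW (h ▸ hb)
  have hafter : MapsTo γ (Ioc t b) W := fun s hs => by_contra fun hsW =>
    (hmax ⟨⟨ht.1.trans hs.1.le, hs.2⟩, hsW⟩).not_gt hs.1
  refine ⟨t, ⟨ht.1, htb⟩, htW, fun s hs => ?_⟩
  rw [← closure_Ioc htb.ne] at hs
  refine hafter.closure_of_continuousOn (hγ.mono ?_) hs
  rw [closure_Ioc htb.ne]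
  exact Icc_subset_Icc_left ht.1

theorem closure_source_inter_preimage_ball_subset {Y E : Type*} [TopologicalSpace Y] [T2Space Y]
    [PseudoMetricSpace E] [ProperSpace E] {e : OpenPartialHomeomorph Y E} {c : E} {r : ℝ}
    (h : Metric.closedBall c r ⊆ e.target) :
    closure (e.source ∩ e ⁻¹' Metric.ball c r) ⊆ e.source ∩ e ⁻¹' Metric.closedBall c r := by
  have hclosed : IsClosed (e.symm '' Metric.closedBall c r) :=
    ((isCompact_closedBall c r).image_of_continuousOn (e.continuousOn_symm.mono h)).isClosed
  rw [e.symm_image_eq_source_inter_preimage h] at hclosed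
  exact closure_minimal
    (inter_subset_inter_right _ (preimage_mono Metric.ball_subset_closedBall)) hclosed

section FlowLines

variable {n : ℕ} {N : Type*} [TopologicalSpace N] [ChartedSpace (Coord n) N]
  {g : Tensor2 n N} {X u : VecField n N} {M : Set N} {e : OpenPartialHomeomorph N (Coord n)} {O : N}

theorem hasDerivWithinAt_chart_comp (he : IsSmoothChart e) {γ : ℝ → N} {t : ℝ} {s : Set ℝ}
    (ht : γ t ∈ e.source) {v : TangentSpace (𝓡 (n + 1)) (γ t)}
    (h : HasMFDerivWithinAt 𝓘(ℝ, ℝ) (𝓡 (n + 1)) γ s t ((1 : ℝ →L[ℝ] ℝ).smulRight v)) :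
    HasDerivWithinAt (fun t => e (γ t)) (chartVec e (γ t) v) s t := by
  have hcomp := (he.mdifferentiable.mdifferentiableAt ht).hasMFDerivAt.comp_hasMFDerivWithinAt t h
  have hderiv : HasFDerivWithinAt (fun t => e (γ t)) ((1 : ℝ →L[ℝ] ℝ).smulRight
      (chartVec e (γ t) v)) s t := by
    refine hcomp.hasFDerivWithinAt.congr_fderiv (ContinuousLinearMap.ext fun r : ℝ => ?_)
    exact map_smul (mfderiv (𝓡 (n + 1)) (𝓡 (n + 1)) e (γ t)) r v
  simpa using hderiv.hasDerivWithinAt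

variable {U : Coord n} {ε : ℝ} {γ : ℝ → N} {a b : ℝ}

theorem norm_chart_sub_sub_smul_le (he : IsSmoothChart e) (hab : a ≤ b)
    (hγ : IsMIntegralCurveOn γ u (Icc a b)) (hsrc : ∀ t ∈ Icc a b, γ t ∈ e.source)
    (hU : ∀ t ∈ Icc a b, ‖chartVec e (γ t) (u (γ t)) - U‖ ≤ ε) :
    ‖e (γ b) - e (γ a) - (b - a) • U‖ ≤ ε * (b - a) := by
  have hderiv : ∀ t ∈ Icc a b, HasDerivWithinAt (fun t => e (γ t) - t • U)
      (chartVec e (γ t) (u (γ t)) - U) (Icc a b) t := fun t ht => by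
    simpa only [one_smul] using (hasDerivWithinAt_chart_comp he (hsrc t ht) (hγ t ht)).fun_sub
      (((hasDerivAt_id' t).smul_const U).hasDerivWithinAt (s := Icc a b))
  have hmean := (convex_Icc a b).norm_image_sub_le_of_norm_hasDerivWithin_le hderiv hU
    (left_mem_Icc.2 hab) (right_mem_Icc.2 hab)
  rw [Real.norm_of_nonneg (sub_nonneg.2 hab)] at hmean
  have hsub : e (γ b) - e (γ a) - (b - a) • U = e (γ b) - b • U - (e (γ a) - a • U) := by module
  rwa [hsub]

theorem exists_notMem_of_tendsto_atBot (he : IsSmoothChart e) (hO : O ∈ e.source) {J : Set ℝ}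
    (hJ : J.OrdConnected) (hγ : IsMIntegralCurveOn γ u J)
    (hlim : Tendsto (fun t : J => γ t) atBot (𝓝 O)) (hb : b ∈ J) {W : Set N} (hW : W ⊆ e.source)
    (hU : ∀ t ∈ J, γ t ∈ W → ‖chartVec e (γ t) (u (γ t)) - U‖ ≤ ε) {c : ℝ} (hc : 0 < c)
    (hgap : ∀ T ≥ 0, ε * T + c ≤ ‖e (γ b) - e O - T • U‖) : ∃ t ∈ J, t ≤ b ∧ γ t ∉ W := by
  by_contra! hstay
  have hnear : ∀ᶠ x in 𝓝 O, e x ∈ Metric.ball (e O) c :=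
    (e.continuousAt hO).eventually (Metric.ball_mem_nhds _ hc)
  have : Nonempty J := ⟨⟨b, hb⟩⟩
  obtain ⟨⟨t, htJ⟩, hdist, htb⟩ :=
    ((hlim.eventually hnear).and (eventually_le_atBot ⟨b, hb⟩)).exists
  have htb : t ≤ b := htb
  have hsub : Icc t b ⊆ J := hJ.out htJ hb
  have hmem : ∀ s ∈ Icc t b, γ s ∈ W := fun s hs => hstay s (hsub hs) hs.2
  have hpath := norm_chart_sub_sub_smul_le he htb (hγ.mono hsub) (fun s hs => hW (hmem s hs))
    fun s hs => hU s (hsub hs) (hmem s hs)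
  have hsum : e (γ b) - e O - (b - t) • U =
      (e (γ b) - e (γ t) - (b - t) • U) + (e (γ t) - e O) := by module
  have htri := norm_add_le (e (γ b) - e (γ t) - (b - t) • U) (e (γ t) - e O)
  rw [← hsum] at htri
  linarith [hgap (b - t) (sub_nonneg.2 htb), mem_ball_iff_norm.1 hdist]

variable [IsManifold (𝓡 (n + 1)) ∞ N]

/-- A flow line that leaves the coordinate ball backwards does so in the timelike past of `O`. -/
theorem IsTimelikeCone.mem_timelikeFuture_of_exit [T2Space N] {r δ : ℝ} {x : N}
    (h : IsTimelikeCone g X e (Metric.closedBall (e O) r) (Metric.ball U δ)) (he : IsSmoothChart e)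
    (hO : O ∈ e.source) (hab : a ≤ b) (hγ : IsMIntegralCurveOn γ u (Icc a b))
    (hx : ∀ t ∈ Icc a b, γ t ∈ timelikeFuture g X x univ)
    (hU : ∀ t ∈ Icc a b, γ t ∈ e.source ∩ e ⁻¹' Metric.closedBall (e O) r →
      ‖chartVec e (γ t) (u (γ t)) - U‖ ≤ ε)
    (ha : γ a ∉ e.source ∩ e ⁻¹' Metric.ball (e O) r)
    (hb : γ b ∈ e.source ∩ e ⁻¹' Metric.ball (e O) r) (hεδ : ε < δ)
    (hsmall : ‖e (γ b) - e O‖ * (‖U‖ + ε) < (δ - ε) * (r - ‖e (γ b) - e O‖)) :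
    O ∈ timelikeFuture g X x univ := by
  obtain ⟨t, ht, htout, hin⟩ := exists_last_exit hγ.continuousOn
    (e.isOpen_inter_preimage Metric.isOpen_ball) hab ha hb
  have hsub : Icc t b ⊆ Icc a b := Icc_subset_Icc_left ht.1
  have hin' : ∀ s ∈ Icc t b, γ s ∈ e.source ∩ e ⁻¹' Metric.closedBall (e O) r := fun s hs =>
    closure_source_inter_preimage_ball_subset h.1 (hin s hs)
  obtain ⟨htsrc, htball⟩ := hin' t (left_mem_Icc.2 ht.2.le)
  have hT : 0 < b - t := sub_pos.2 ht.2
  have hfar : r ≤ ‖e (γ t) - e O‖ :=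
    not_lt.1 fun hlt => htout ⟨htsrc, mem_ball_iff_norm.2 hlt⟩
  have hdir : ‖(b - t)⁻¹ • (e O - e (γ t)) - U‖ < δ := norm_inv_smul_sub_sub_lt hT hεδ hfar
    (norm_chart_sub_sub_smul_le he ht.2.le (hγ.mono hsub) (fun s hs => (hin' s hs).1)
      fun s hs => hU s (hsub hs) (hin' s hs)) hsmall
  have hend : e (γ t) + (b - t) • (b - t)⁻¹ • (e O - e (γ t)) = e O := by
    rw [smul_inv_smul₀ hT.ne', add_sub_cancel]
  have hr : 0 ≤ r := Metric.nonempty_closedBall.1 ⟨_, htball⟩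
  have hmem := h.add_smul_mem_timelikeFuture_of_mem he (convex_closedBall _ _) (x := x)
    (by rw [e.left_inv htsrc]; exact hx t (hsub (left_mem_Icc.2 ht.2.le))) htball
    (mem_ball_iff_norm.2 hdir) hT (by rw [hend]; exact Metric.mem_closedBall_self hr)
  rwa [hend, e.left_inv hO] at hmem

theorem IsTimelikeCone.mem_timelikeFuture_of_tendsto_atBot [T2Space N] {r δ : ℝ} {x : N}
    (h : IsTimelikeCone g X e (Metric.closedBall (e O) r) (Metric.ball U δ)) (he : IsSmoothChart e)
    (hO : O ∈ e.source) {J : Set ℝ} (hJ : J.OrdConnected) (hγ : IsMIntegralCurveOn γ u J)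
    (hx : ∀ t ∈ J, γ t ∈ timelikeFuture g X x univ) (hlim : Tendsto (fun t : J => γ t) atBot (𝓝 O))
    (hU : ∀ t ∈ J, γ t ∈ e.source ∩ e ⁻¹' Metric.closedBall (e O) r →
      ‖chartVec e (γ t) (u (γ t)) - U‖ ≤ ε) (hb : b ∈ J)
    (hball : γ b ∈ e.source ∩ e ⁻¹' Metric.ball (e O) r) (hεδ : ε < δ)
    (hsmall : ‖e (γ b) - e O‖ * (‖U‖ + ε) < (δ - ε) * (r - ‖e (γ b) - e O‖)) {c : ℝ} (hc : 0 < c)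
    (hgap : ∀ T ≥ 0, ε * T + c ≤ ‖e (γ b) - e O - T • U‖) : O ∈ timelikeFuture g X x univ := by
  obtain ⟨t, ht, htb, hout⟩ := exists_notMem_of_tendsto_atBot he hO hJ hγ hlim hb
    inter_subset_left hU hc hgap
  have hsub : Icc t b ⊆ J := hJ.out ht hb
  exact h.mem_timelikeFuture_of_exit he hO htb (hγ.mono hsub) (fun t' ht' => hx t' (hsub ht'))
    (fun t' ht' => hU t' (hsub ht'))
    (fun hin => hout ⟨hin.1, Metric.ball_subset_closedBall hin.2⟩) hball hεδ hsmall

end FlowLines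

section PastEndpoint

variable {n : ℕ} {N : Type*} [TopologicalSpace N] [ChartedSpace (Coord n) N]
  {g : Tensor2 n N} {X u : VecField n N} {M : Set N} {e : OpenPartialHomeomorph N (Coord n)} {O : N}

theorem exists_closedBall_subset_and_norm_chartVec_sub_le (hO : O ∈ e.source) {U : Coord n} {ε : ℝ}
    (hε : 0 < ε) {K : Set (Coord n)} (hK : K ∈ 𝓝 (e O))
    (hU : Tendsto (fun x => chartVec e x (u x)) (𝓝[M] O) (𝓝 U)) :
    ∃ r > 0, Metric.closedBall (e O) r ⊆ K ∧ ∀ x ∈ M,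
      x ∈ e.source ∩ e ⁻¹' Metric.closedBall (e O) r → ‖chartVec e x (u x) - U‖ ≤ ε := by
  have hclose : ∀ᶠ x in 𝓝 O, x ∈ M → ‖chartVec e x (u x) - U‖ ≤ ε :=
    (eventually_nhdsWithin_iff.1 (hU.eventually (Metric.closedBall_mem_nhds U hε))).mono
      fun _ hx hxM => mem_closedBall_iff_norm.1 (hx hxM)
  obtain ⟨r, hr, hball⟩ := Metric.nhds_basis_closedBall.mem_iff.1
    (inter_mem hK ((e.tendsto_symm hO).eventually hclose))
  refine ⟨r, hr, fun y hy => (hball hy).1, fun x hxM hx => ?_⟩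
  have hxe := (hball hx.2).2
  rw [mem_ofPred_eq, e.left_inv hx.1] at hxe
  exact hxe hxM

variable [IsManifold (𝓡 (n + 1)) ∞ N]

/-- Otherwise start a flow line at a point near `O` in a direction `v` that is close to `U` but not
parallel to it. Followed backwards the flow line misses `O`, so it leaves a small coordinate ball,
and it does so in the timelike past of `O`: then `O ∈ I⁺(O) = M`. -/
theorem not_tendsto_chartVec [T2Space N] (hn : 1 ≤ n) (hg : IsContinuousSpacetime g X)
    (he : IsSmoothChart e) (hO : O ∈ e.source) (hM : IsOpen M) (hOM : O ∉ M)
    (hI : M = timelikeFuture g X O univ)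
    (hu : ContMDiffOn (𝓡 (n + 1)) (𝓡 (n + 1)).tangent 1
      (fun x => (⟨x, u x⟩ : TangentBundle (𝓡 (n + 1)) N)) M)
    (hend : ∀ γ J, IsMaximalIntegralCurveIn u M γ J → Tendsto (fun t : J => γ t) atBot (𝓝 O))
    {U : Coord n} (hself : chartForm g e (e O) U U < 0)
    (hfut : chartForm g e (e O) (chartVec e O (X O)) U < 0) :
    ¬ Tendsto (fun x => chartVec e x (u x)) (𝓝[M] O) (𝓝 U) := by
  intro hU
  obtain ⟨K, hK, δ, hδ, hcone⟩ := hg.exists_isTimelikeCone he hO hself hfut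
  have hU0 : U ≠ 0 := by
    rintro rfl
    simp [chartForm] at hself
  obtain ⟨v, hvU, hv⟩ := exists_norm_sub_lt_linearIndependent_pair (by simp; omega) hU0 hδ
  obtain ⟨κ, hκ, hgap⟩ := exists_mul_abs_add_abs_le_norm_of_linearIndependent hv
  obtain ⟨ε, hε, hε_lt⟩ : ∃ ε, 0 < ε ∧ ε < min κ δ := exists_between (lt_min hκ hδ)
  obtain ⟨hεκ, hεδ⟩ := lt_min_iff.1 hε_lt
  obtain ⟨r, hr, hrK, hnear⟩ := exists_closedBall_subset_and_norm_chartVec_sub_le hO hε hK hU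
  obtain ⟨s, hs, hsr, hsmall⟩ := exists_pos_norm_smul_mul_lt v hr (sub_pos.2 hεδ) (‖U‖ + ε)
  have hball : e O + s • v ∈ Metric.ball (e O) r := by simpa using hsr
  have htarget := hcone.1 (hrK (Metric.ball_subset_closedBall hball))
  have hq : e.symm (e O + s • v) ∈ M := by
    have := (hcone.mono hrK).add_smul_mem_timelikeFuture he (convex_closedBall _ _)
      (Metric.mem_closedBall_self hr.le) (mem_ball_iff_norm.2 hvU) hs
      (Metric.ball_subset_closedBall hball)
    rwa [e.left_inv hO, ← hI] at this
  obtain ⟨γ, J, hγ, h0, hγ0⟩ :=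
    exists_isMaximalIntegralCurveIn hM hq (hu.contMDiffAt (hM.mem_nhds hq)) 0
  obtain ⟨-, -, hJ, hJM, hγu⟩ := hγ.1
  have heγ0 : e (γ 0) = e O + s • v := by rw [hγ0, e.right_inv htarget]
  have hγball : γ 0 ∈ e.source ∩ e ⁻¹' Metric.ball (e O) r :=
    ⟨hγ0 ▸ e.map_target htarget, by rwa [mem_preimage, heγ0]⟩
  have hmiss : ∀ T ≥ 0, ε * T + κ * s ≤ ‖s • v - T • U‖ := fun T hT => by
    have h := hgap (-T) s
    rw [abs_neg, abs_of_nonneg hT, abs_of_pos hs, neg_smul, neg_add_eq_sub] at h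
    linarith [mul_le_mul_of_nonneg_right hεκ.le hT]
  have hOI : O ∈ timelikeFuture g X O univ :=
    (hcone.mono hrK).mem_timelikeFuture_of_tendsto_atBot he hO hJ hγu
      (fun t ht => hI.subset (hJM ht)) (hend γ J hγ) (fun t ht => hnear _ (hJM ht)) h0 hγball hεδ
      (by rwa [heγ0, add_sub_cancel_left]) (mul_pos hκ hs)
      (by rwa [heγ0, add_sub_cancel_left])
  exact hOM (hI.superset hOI)

end PastEndpoint

section Extension

variable {n : ℕ} {N : Type*} [TopologicalSpace N] {M : Set N} {O : N}

theorem IsContExt.tendsto {f f' : N → ℝ} (h : IsContExt M O f f') :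
    Tendsto f (𝓝[M] O) (𝓝 (f' O)) :=
  ((h.1 O (mem_insert _ _)).tendsto.mono_left (nhdsWithin_mono _ (subset_insert _ _))).congr'
    (eventually_of_mem self_mem_nhdsWithin h.2)

variable [ChartedSpace (Coord n) N] {g : Tensor2 n N} {X u : VecField n N}

theorem TensorExtends.exists_tendsto_compMatrix {T : Tensor2 n N} (h : TensorExtends T M O) :
    ∃ e : OpenPartialHomeomorph N (Coord n), IsSmoothChart e ∧ O ∈ e.source ∧
      ∃ B, Tendsto (fun x => compMatrix T e (e x)) (𝓝[M] O) (𝓝 B) := by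
  obtain ⟨e, he, hO, hT⟩ := h
  choose f hf using hT
  refine ⟨e, he, hO, fun i j => f i j O, tendsto_pi_nhds.2 fun i => tendsto_pi_nhds.2 fun j => ?_⟩
  have hlim := (hf i j).tendsto
  rwa [inter_comm, nhdsWithin_inter_of_mem'
    (mem_nhdsWithin_of_mem_nhds (e.open_source.mem_nhds hO))] at hlim

variable [IsManifold (𝓡 (n + 1)) ∞ N]

theorem IsPerfectFluidSolution.isContExt_scalarCurvature {ρ p ρ' p' : N → ℝ}
    (h : IsPerfectFluidSolution g X M u ρ p) (hn : 2 ≤ n) (hg : ∀ x, IsLorentzForm n (g x))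
    (hρ : IsContExt M O ρ ρ') (hp : IsContExt M O p p') :
    IsContExt M O (scalarCurvature g)
      fun x => 16 * Real.pi / ((n : ℝ) - 1) * (ρ' x - n * p' x) := by
  refine ⟨continuousOn_const.mul (hρ.1.sub (continuousOn_const.mul hp.1)), fun x hx => ?_⟩
  simp only [hρ.2 hx, hp.2 hx, h.scalarCurvature_eq hn hg hx]

/-- The Einstein equations, solved for `u⋆ ⊗ u⋆` where `ρ + p ≠ 0`. -/
theorem IsPerfectFluidSolution.exists_tendsto_vecMulVec {ρ p ρ' p' : N → ℝ}
    {e : OpenPartialHomeomorph N (Coord n)} {B : Matrix (Fin (n + 1)) (Fin (n + 1)) ℝ}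
    (h : IsPerfectFluidSolution g X M u ρ p) (hn : 2 ≤ n) (hg : IsContinuousSpacetime g X)
    (he : IsSmoothChart e) (hO : O ∈ e.source)
    (hric : Tendsto (fun x => compMatrix (ricci g) e (e x)) (𝓝[M] O) (𝓝 B))
    (hρ : IsContExt M O ρ ρ') (hp : IsContExt M O p p') (hsum : ρ' O + p' O ≠ 0) :
    ∃ A, Tendsto (fun x => Matrix.vecMulVec
      ((compMatrix g e (e x)).mulVec (chartVec e x (u x)).ofLp)
      ((compMatrix g e (e x)).mulVec (chartVec e x (u x)).ofLp)) (𝓝[M] O) (𝓝 A) := by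
  have hG : Tendsto (fun x => compMatrix g e (e x)) (𝓝[M] O) (𝓝 (compMatrix g e (e O))) :=
    (hg.continuousAt_compMatrix he (e.map_source hO)).tendsto.comp
      (e.continuousAt hO).continuousWithinAt
  have hR := (h.isContExt_scalarCurvature hn hg.lorentz hρ hp).tendsto
  have hcoef := (hR.const_mul (1 / 2)).add (hp.tendsto.const_mul (8 * Real.pi))
  have hfactor := (hρ.tendsto.add hp.tendsto).const_mul (8 * Real.pi)
  have hfactor_ne : 8 * Real.pi * (ρ' O + p' O) ≠ 0 := mul_ne_zero (by positivity) hsum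
  refine ⟨_, ((hfactor.inv₀ hfactor_ne).smul (hric.sub (hcoef.smul hG))).congr' ?_⟩
  filter_upwards [nhdsWithin_le_nhds (e.open_source.mem_nhds hO), self_mem_nhdsWithin,
    hfactor.eventually_ne hfactor_ne] with x hxe hxM hx
  have hE := h.compMatrix_ricci hg.lorentz he (e.map_source hxe) (by rwa [e.left_inv hxe])
  rw [e.left_inv hxe] at hE
  rw [hE, add_sub_cancel_left, inv_smul_smul₀ hx]

theorem IsPerfectFluidSolution.add_eq_zero [T2Space N] {ρ p ρ' p' : N → ℝ}
    (h : IsPerfectFluidSolution g X M u ρ p) (hn : 2 ≤ n) (hg : IsContinuousSpacetime g X)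
    (hM : IsOpen M) (hO : O ∈ closure M \ M) (hI : M = timelikeFuture g X O univ)
    (hend : ∀ γ J, IsMaximalIntegralCurveIn u M γ J → Tendsto (fun t : J => γ t) atBot (𝓝 O))
    (hric : TensorExtends (ricci g) M O) (hρ : IsContExt M O ρ ρ') (hp : IsContExt M O p p') :
    ρ' O + p' O = 0 := by
  by_contra hsum
  have : NeBot (𝓝[M] O) := mem_closure_iff_nhdsWithin_neBot.1 hO.1
  obtain ⟨e, he, hOe, B, hB⟩ := hric.exists_tendsto_compMatrix
  obtain ⟨A, hA⟩ := h.exists_tendsto_vecMulVec hn hg he hOe hB hρ hp hsum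
  obtain ⟨U, hU, hUU, hXU⟩ := hg.exists_tendsto_chartVec he hOe h.unit h.future hA
  exact not_tendsto_chartVec (by omega) hg he hOe hM hO.2 hI (h.smooth_u.of_le (by simp)) hend
    (hUU.trans_lt neg_one_lt_zero) hXU hU

end Extension

end C0Spacetime

theorem corollary2p4_general (n : ℕ) (hn : 2 ≤ n)
    {N : Type*} [TopologicalSpace N] [T2Space N]
    [ChartedSpace (Coord n) N] [IsManifold (𝓡 (n + 1)) ∞ N]
    (g : Tensor2 n N) (X : VecField n N) (M : Set N) (hM : IsContinuousExtension g X M)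
    (O : N) (hO : O ∈ closure M \ M) (hI : M = timelikeFuture g X O univ)
    (u : VecField n N) (ρ p : N → ℝ)
    (ha : IsPerfectFluidSolution g X M u ρ p)
    (hend : ∀ (γ : ℝ → N) (J : Set ℝ), IsMaximalIntegralCurveIn u M γ J →
      Tendsto (fun t : J => γ t) atBot (𝓝 O))
    (hc : TensorExtends (ricci g) M O ∧ (∃ ρ', IsContExt M O ρ ρ') ∧ ∃ p', IsContExt M O p p') :
    (∃ R', IsContExt M O (scalarCurvature g) R') ∧
    ∀ R' ρ' : N → ℝ, IsContExt M O (scalarCurvature g) R' → IsContExt M O ρ ρ' →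
      R' O = 16 * Real.pi * (((n : ℝ) + 1) / ((n : ℝ) - 1)) * ρ' O ∧
      (n + 1 = 4 → R' O = 32 * Real.pi * ρ' O) := by
  obtain ⟨hric, ⟨ρ₀, hρ₀⟩, ⟨p₀, hp₀⟩⟩ := hc
  have : NeBot (𝓝[M] O) := mem_closure_iff_nhdsWithin_neBot.1 hO.1
  have hR {ρ' : N → ℝ} (hρ' : IsContExt M O ρ ρ') := ha.isContExt_scalarCurvature hn
    hM.spacetime.lorentz hρ' hp₀
  refine ⟨⟨_, hR hρ₀⟩, fun R' ρ' hR' hρ' => ?_⟩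
  have hsum : ρ' O + p₀ O = 0 :=
    ha.add_eq_zero hn hM.spacetime hM.isOpen hO hI hend hric hρ' hp₀
  have hRO : R' O = 16 * Real.pi / ((n : ℝ) - 1) * (ρ' O - n * p₀ O) :=
    tendsto_nhds_unique hR'.tendsto (hR hρ').tendsto
  have hmain : R' O = 16 * Real.pi * (((n : ℝ) + 1) / ((n : ℝ) - 1)) * ρ' O := by
    rw [hRO, eq_neg_of_add_eq_zero_right hsum]
    ring
  refine ⟨hmain, fun h4 => ?_⟩
  obtain rfl : n = 3 := by omega
  rw [hmain]
  ring

theorem corollary2p4 (n : ℕ) (hn : 2 ≤ n)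
    {N : Type*} [TopologicalSpace N] [T2Space N] [SecondCountableTopology N]
    [ChartedSpace (Coord n) N] [IsManifold (𝓡 (n + 1)) ∞ N]
    (g : Tensor2 n N) (X : VecField n N) (M : Set N) (hM : IsContinuousExtension g X M)
    (O : N) (hO : O ∈ pastBoundary g X M) (hI : M = timelikeFuture g X O univ)
    (u : VecField n N) (ρ p : N → ℝ)
    (ha : IsPerfectFluidSolution g X M u ρ p)
    (hb : HasPastEndpoint g X M u O)
    (hc : TensorExtends (ricci g) M O ∧ (∃ ρ', IsContExt M O ρ ρ') ∧ ∃ p', IsContExt M O p p')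
    (hd : IsStronglyCausalAt g X O ∨ PastBoundaryLocallyInFuture g X M O) :
    (∃ R', IsContExt M O (scalarCurvature g) R') ∧
    ∀ R' ρ' : N → ℝ, IsContExt M O (scalarCurvature g) R' → IsContExt M O ρ ρ' →
      R' O = 16 * Real.pi * (((n : ℝ) + 1) / ((n : ℝ) - 1)) * ρ' O ∧
      (n + 1 = 4 → R' O = 32 * Real.pi * ρ' O) := by
  exact corollary2p4_general n hn g X M hM O hO.1 hI u ρ p ha hb.tendsto hc
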